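/- Let $d \ge 3$ and let $\mathbb T_d$ be the $d$-regular tree with vertex set $V$, edge set $E$ and a fixed root $o \in V$. Identify a set of edges with its indicator in $\{0,1\}^{E}$, equipped with the product $\sigma$-field, and let $\mathrm{Aut}(\mathbb T_d)$ act on $\{0,1\}^E$ and on $[0,1]^V$ by $(\gamma\omega)(x) = \omega(\gamma^{-1}x)$. Then there is exactly one $\mathrm{Aut}(\mathbb T_d)$-invariant probability measure $\mu^{\rm pm}$ on the set of perfect matchings of $\mathbb T_d$, i.e., exactly one invariant probability measure on $\{0,1\}^E$ that is carried by the perfect matchings. Moreover: (1) $\mu^{\rm pm}$ is a factor of IID: there is a measurable $\mathrm{Aut}(\mathbb T_d)$-equivariant map $\phi \colon [0,1]^V \to \{0,1\}^E$ such that $\mu^{\rm pm}$ is the push-forward under $\phi$ of the product of Lebesgue measures on $[0,1]^V$. (2) The tail $\sigma$-field of $\mu^{\rm pm}$ is full. That is, let $B_r$ be the subgraph induced on the vertices at distance at most $r$ from $o$, let $\mathcal F(K)$ be the $\sigma$-field on $\{0,1\}^E$ generated by the coordinates in $K \subseteq E$, and let $\mathcal T = \bigcap_{r \ge 0} \mathcal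 F(E \setminus E(B_r))$. Then every measurable subset of $\{0,1\}^E$ coincides up to a $\mu^{\rm pm}$-null set with an element of $\mathcal T$; indeed, the trace of $\mathcal T$ on the set of perfect matchings contains every measurable set of perfect matchings. -/

import Mathlib

open MeasureTheory

namespace TreeMatching

variable {V : Type*} (G : SimpleGraph V)

/-- The configuration space `{0,1}^E`, with its product `σ`-field. A configuration is
the indicator function of a set of edges. -/
abbrev Config : Type _ := G.edgeSet → Bool

/-- The label space `[0,1]^V`, with its product `σ`-field. -/
abbrev Labels (V : Type*) : Type _ := V → unitInterval

/-- The product of Lebesgue measure over all vertices: the law of IID uniform labels. -/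
noncomputable def iidLaw (V : Type*) : Measure (Labels V) :=
  Measure.infinitePi fun _ : V => (volume : Measure unitInterval)

variable {G} in
/-- The action of `Aut(G)` on labels: `(γ ω)(x) = ω(γ⁻¹ x)`. -/
def actLabels (γ : G ≃g G) (ω : Labels V) : Labels V :=
  fun x => ω (γ.symm x)

variable {G} in
/-- The action of `Aut(G)` on edge configurations: `(γ ω)(e) = ω(γ⁻¹ e)`. -/
def actConfig (γ : G ≃g G) (ω : Config G) : Config G :=
  fun e => ω (γ.symm.mapEdgeSet e)

/-- The set of perfect matchings of `G`, as a subset of `{0,1}^E`. -/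
def perfectMatchings : Set (Config G) :=
  {ω | ∃ M : G.Subgraph, M.IsPerfectMatching ∧
    ∀ e : G.edgeSet, ω e = true ↔ (e : Sym2 V) ∈ M.edgeSet}

/-- `μ` is an `Aut(G)`-invariant probability measure on the set of perfect matchings of `G`
(a measure on `{0,1}^E` that is carried by the perfect matchings). -/
structure IsInvariantMatchingLaw (μ : Measure (Config G)) : Prop where
  isProbabilityMeasure : IsProbabilityMeasure μ
  carried : ∀ᵐ ω ∂μ, ω ∈ perfectMatchings G
  invariant : ∀ γ : G ≃g G, MeasurePreserving (actConfig γ) μ μ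

/-- `μ` is a factor of IID: the push-forward of the product Lebesgue measure on `[0,1]^V`
under a measurable `Aut(G)`-equivariant map `[0,1]^V → {0,1}^E`. -/
def IsFIID (μ : Measure (Config G)) : Prop :=
  ∃ φ : Labels V → Config G, Measurable φ ∧
    (∀ (γ : G ≃g G) (ω : Labels V), φ (actLabels γ ω) = actConfig γ (φ ω)) ∧
    (iidLaw V).map φ = μ

/-- The edges of the subgraph induced on the ball of radius `r` around `o`. -/
def ballEdges (o : V) (r : ℕ) : Set G.edgeSet :=
  {e | ∀ v ∈ (e : Sym2 V), G.dist o v ≤ r}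

/-- The `σ`-field on `{0,1}^E` generated by the coordinates in `K`. -/
@[reducible] def sigmaField (K : Set G.edgeSet) : MeasurableSpace (Config G) :=
  ⨆ e ∈ K, MeasurableSpace.comap (fun ω : Config G => ω e) inferInstance

/-- The tail `σ`-field on `{0,1}^E`. -/
@[reducible] def tailField (o : V) : MeasurableSpace (Config G) :=
  ⨅ r : ℕ, sigmaField G (ballEdges G o r)ᶜ

/-- The tail `σ`-field is full for `μ`: modulo `μ`-null sets it contains every event. -/
def HasFullTail (o : V) (μ : Measure (Config G)) : Prop :=
  ∀ A : Set (Config G), MeasurableSet A →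
    ∃ B : Set (Config G), MeasurableSet[tailField G o] B ∧ A =ᵐ[μ] B

end TreeMatching

/-! Uniqueness is homogeneity. A perfect matching of the tree extends to a proper edge colouring in
which it is one colour class (`exists_edgeColouring`), and coloured regular trees are homogeneous,
so the stabiliser of `o` acts transitively on perfect matchings (`exists_iso_partner`). An invariant
law therefore gives equal mass to all patterns that perfect matchings leave on a ball, of which
there are finitely many; these marginals determine it.

Fullness of the tail is deterministic. At a vertex of the outermost sphere, the edge towards the
root is matched exactly when no outward edge is. Hence the matching outside a ball can be continued
inwards, one sphere at a time (`comap_sigmaField_eq`).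

Existence as a factor of IID rests on a spectral gap. The averaging operator contracts centred
equivariant fields of IID labels in L² by the factor 17/18 (`integral_avgField_sq_le_of_centred`),
so equivariant random sets expand (`measure_nbrSet_expansion`). If a random matching has no
augmenting path of length at most 2K+1, the set reached from the free vertices by alternating walks
multiplies its odds by at least (18/17)² per step, yet must avoid the free vertices; so the free
density is at most (17/18)^(K+1). A matching with free density p > 0 thus has augmenting paths of
length O(1 + log(1/p)). Flipping a sparse equivariant family of them with density q > 0 lowers p by
at least q and alters the matching at the root with probability O((1 + log(1/p)) q)
(`exists_augment`).

Since (1 + log(1/p))√p is bounded, this cost is at most a constant times the drop of √p. A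
variational argument finishes: nearly optimal improvements have summable costs, so they converge
almost surely, and a limit with free vertices could be improved once more, against near-optimality
(`exists_isRandomMatching_freeProb_eq_zero`). -/

namespace TreeMatching

/-! ### Trees, edge colourings and their automorphisms -/

section Tree

variable {V : Type*} {G : SimpleGraph V}

lemma eq_of_adj_of_dist_lt (hG : G.IsTree) (o : V) {v p q : V} (hp : G.Adj v p) (hq : G.Adj v q)
    (hpd : G.dist o p < G.dist o v) (hqd : G.dist o q < G.dist o v) : p = q := by
  have key : ∀ p, G.Adj v p → G.dist o p < G.dist o v →
      ∃ w : G.Walk o v, w.IsPath ∧ w.penultimate = p := by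
    intro p hp hpd
    obtain ⟨w, hw, hl⟩ := hG.connected.exists_path_of_dist o p
    refine ⟨w.concat hp.symm, ?_, by simp⟩
    rw [SimpleGraph.Walk.concat_isPath_iff]
    refine ⟨hw, fun hv => ?_⟩
    classical
    have h1 := w.length_takeUntil_le_length hv
    have h2 := SimpleGraph.dist_le (w.takeUntil v hv)
    omega
  obtain ⟨w, hw, rfl⟩ := key p hp hpd
  obtain ⟨w', hw', rfl⟩ := key q hq hqd
  rw [(hG.existsUnique_path o v).unique hw hw']

/-- Each vertex other than the start has only one neighbour closer to the start. A walk that has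
just moved away could come closer only by returning to the vertex it came from. -/
lemma dist_of_nonbacktracking (hG : G.IsTree) (x : ℕ → V) (n : ℕ)
    (hadj : ∀ i < n, G.Adj (x i) (x (i + 1))) (hne : ∀ i, i + 1 < n → x i ≠ x (i + 2)) :
    G.dist (x 0) (x n) = n := by
  have key : ∀ i, i + 1 ≤ n → G.dist (x 0) (x (i + 1)) = G.dist (x 0) (x i) + 1 := by
    intro i
    induction i with
    | zero =>
      intro h
      simp [SimpleGraph.dist_eq_one_iff_adj.2 (hadj 0 h)]
    | succ i ih =>
      intro h
      have h1 := ih (by omega)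
      rcases hG.dist_eq_dist_add_one_of_adj (x 0) (hadj (i + 1) h) with h2 | h2
      · exact absurd (eq_of_adj_of_dist_lt hG (x 0) (hadj i (by omega)).symm (hadj (i + 1) h)
          (by omega) (by omega)) (hne i h)
      · exact h2
  have : ∀ i ≤ n, G.dist (x 0) (x i) = i := by
    intro i
    induction i with
    | zero => simp
    | succ i ih => intro h; rw [key i h, ih (by omega)]
  exact this n le_rfl

lemma injOn_of_nonbacktracking (hG : G.IsTree) (x : ℕ → V) (n : ℕ)
    (hadj : ∀ i < n, G.Adj (x i) (x (i + 1))) (hne : ∀ i, i + 1 < n → x i ≠ x (i + 2)) :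
    Set.InjOn x (Set.Iic n) := by
  have key : ∀ i j, i ≤ j → j ≤ n → x i = x j → i = j := by
    intro i j hij hj h
    have := dist_of_nonbacktracking hG (fun k => x (i + k)) (j - i)
      (fun k hk => by simpa [add_assoc] using hadj (i + k) (by omega))
      (fun k hk => by simpa [add_assoc] using hne (i + k) (by omega))
    simp only [add_zero] at this
    rw [Nat.add_sub_cancel' hij, h, SimpleGraph.dist_self] at this
    omega
  intro i hi j hj h
  rcases le_total i j with hij | hij
  · exact key i j hij hj h
  · exact (key j i hij hi h.symm).symm

lemma exists_adj_dist_add_one (hG : G.Connected) (o : V) {v : V} (hv : v ≠ o) :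
    ∃ p, G.Adj p v ∧ G.dist o v = G.dist o p + 1 := by
  obtain ⟨w, hl⟩ := hG.exists_walk_length_eq_dist v o
  cases w with
  | nil => exact absurd rfl hv
  | @cons _ p _ h w =>
    refine ⟨p, h.symm, ?_⟩
    have h1 := SimpleGraph.dist_le w
    have h2 := h.diff_dist_adj (u := o)
    simp only [SimpleGraph.Walk.length_cons] at hl
    rw [SimpleGraph.dist_comm (u := v)] at hl
    rw [SimpleGraph.dist_comm (v := o)] at h1
    omega

/-- A family of vertex data in a tree can be chosen outward from the root. -/
lemma exists_assignment (hG : G.IsTree) (o : V) {β : Type*} (Good : V → β → Prop)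
    (R : V → V → β → β → Prop) (h0 : ∃ b, Good o b)
    (hext : ∀ p v, G.Adj p v → ∀ b, Good p b → ∃ b', Good v b' ∧ R p v b b') :
    ∃ f : V → β, (∀ v, Good v (f v)) ∧
      ∀ p v, G.Adj p v → G.dist o v = G.dist o p + 1 → R p v (f p) (f v) := by
  classical
  choose! par hpar hdist using fun v (hv : v ≠ o) => exists_adj_dist_add_one hG.connected o hv
  choose! nxt hnxt hR using hext
  -- Well-founded recursion on the distance to the root; carrying `Good` in the subtype makes the
  -- extension step applicable at each parent.
  let F : ∀ v, {b // Good v b} := (measure (G.dist o)).wf.fix (fun v ih =>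
    if h : v = o then ⟨h0.choose, by rw [h]; exact h0.choose_spec⟩ else
      let b := ih (par v) (by have := hdist v h; simp only [WellFoundedRelation.rel, InvImage]; omega)
      ⟨nxt (par v) v b.1, hnxt _ _ (hpar v h) _ b.2⟩)
  have hF : ∀ v, v ≠ o → (F v).1 = nxt (par v) v (F (par v)).1 := by
    intro v hv
    simp only [F]
    rw [WellFounded.fix_eq, dif_neg hv]
  refine ⟨fun v => (F v).1, fun v => (F v).2, fun p v hadj hd => ?_⟩
  have hv : v ≠ o := by rintro rfl; simp at hd
  have : p = par v := eq_of_adj_of_dist_lt hG o hadj.symm (hpar v hv).symm (by omega)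
    (by have := hdist v hv; omega)
  subst this
  simp only [hF v hv]
  exact hR _ _ hadj _ (F _).2

/-- `n v` enumerates the neighbours of `v` by the colours of a proper edge colouring
in which every vertex sees every colour. -/
structure IsEdgeColouring (G : SimpleGraph V) {d : ℕ} (n : V → Fin d → V) : Prop where
  adj : ∀ v i, G.Adj v (n v i)
  inj : ∀ v, Function.Injective (n v)
  surj : ∀ v w, G.Adj v w → ∃ i, n v i = w
  invol : ∀ v i, n (n v i) i = v

/-- `m v` is the partner of `v` in a perfect matching. -/
structure IsPartner (G : SimpleGraph V) (m : V → V) : Prop where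
  adj : ∀ v, G.Adj v (m v)
  invol : ∀ v, m (m v) = v

/-- When a colouring is extended to a new vertex, two colours are already prescribed: that of the
edge to the parent and that of the matching edge. The hypothesis `h` says that the two prescriptions
are compatible. -/
lemma exists_enumeration_nbrs [G.LocallyFinite] {d : ℕ} {v : V} (hd : G.degree v = d)
    {i j : Fin d} {w u : V} (hw : G.Adj v w) (hu : G.Adj v u) (h : i = j ↔ w = u) :
    ∃ b : Fin d → V, ((∀ i, G.Adj v (b i)) ∧ Function.Injective b ∧
      ∀ w, G.Adj v w → ∃ i, b i = w) ∧ b i = w ∧ b j = u := by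
  classical
  have e0 : Fin d ≃ G.neighborSet v :=
    (Fintype.equivFinOfCardEq (by rw [SimpleGraph.card_neighborSet_eq_degree, hd])).symm
  let e1 := (Equiv.swap i (e0.symm ⟨w, hw⟩)).trans e0
  have h1 : e1 i = ⟨w, hw⟩ := by simp [e1]
  let e2 := (Equiv.swap j (e1.symm ⟨u, hu⟩)).trans e1
  have h2 : e2 j = ⟨u, hu⟩ := by simp [e2]
  have h3 : e2 i = ⟨w, hw⟩ := by
    by_cases hij : i = j
    · subst hij; rw [h2]; simp [h.1 rfl]
    · have : i ≠ e1.symm ⟨u, hu⟩ := by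
        intro hh
        rw [Equiv.eq_symm_apply, h1] at hh
        exact hij (h.2 (congrArg Subtype.val hh))
      simp [e2, Equiv.swap_apply_of_ne_of_ne hij this, h1]
  refine ⟨fun i => e2 i, ⟨fun i => (e2 i).2, fun a b hab => e2.injective (Subtype.ext hab),
    fun w hw => ⟨e2.symm ⟨w, hw⟩, by simp⟩⟩, by simp [h3], by simp [h2]⟩

/-- Colours are chosen outward from a root, and only the edge to the parent constrains the next
vertex. Having the matching clause conditional lets one construction serve both with and without a
prescribed colour class. -/
lemma exists_edgeColouring [G.LocallyFinite] (hG : G.IsTree) {d : ℕ}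
    (hreg : G.IsRegularOfDegree d) (i₀ : Fin d) (m : V → V) :
    ∃ n : V → Fin d → V, IsEdgeColouring G n ∧ (IsPartner G m → ∀ v, n v i₀ = m v) := by
  classical
  obtain ⟨o⟩ := hG.connected.nonempty
  obtain ⟨f, hf, hR⟩ := exists_assignment hG o (β := Fin d → V)
    (fun v b => ((∀ i, G.Adj v (b i)) ∧ Function.Injective b ∧
      ∀ w, G.Adj v w → ∃ i, b i = w) ∧ (IsPartner G m → b i₀ = m v))
    (fun p v b b' => ∀ i, b i = v → b' i = p)
    (by
      have : 0 < G.degree o := by rw [hreg o]; exact i₀.pos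
      obtain ⟨u, hu⟩ := (G.degree_pos_iff_exists_adj o).1 this
      by_cases hm : IsPartner G m
      · obtain ⟨b, hb, h1, -⟩ := exists_enumeration_nbrs (hreg o) (i := i₀) (j := i₀)
          (hm.adj o) (hm.adj o) (by simp)
        exact ⟨b, hb, fun _ => h1⟩
      · obtain ⟨b, hb, h1, -⟩ := exists_enumeration_nbrs (hreg o) (i := i₀) (j := i₀)
          hu hu (by simp)
        exact ⟨b, hb, fun h => absurd h hm⟩)
    (by
      rintro p v hpv b ⟨⟨hb1, hb2, hb3⟩, hb4⟩
      obtain ⟨j, rfl⟩ := hb3 v hpv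
      by_cases hm : IsPartner G m
      · obtain ⟨b', hb', h1, h2⟩ := exists_enumeration_nbrs (hreg (b j)) (i := i₀) (j := j)
          (hm.adj (b j)) hpv.symm (by
            constructor
            · rintro rfl; rw [hb4 hm, hm.invol]
            · intro h
              apply hb2
              rw [hb4 hm, ← h, hm.invol])
        exact ⟨b', ⟨hb', fun _ => h1⟩, fun i hi => by rw [hb2 hi, h2]⟩
      · obtain ⟨b', hb', h1, -⟩ := exists_enumeration_nbrs (hreg (b j)) (i := j) (j := j)
          hpv.symm hpv.symm (by simp)
        exact ⟨b', ⟨hb', fun h => absurd h hm⟩, fun i hi => by rw [hb2 hi, h1]⟩)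
  refine ⟨f, ⟨fun v => (hf v).1.1, fun v => (hf v).1.2.1, fun v => (hf v).1.2.2, ?_⟩,
    fun hm v => (hf v).2 hm⟩
  intro v i
  have hadj := (hf v).1.1 i
  rcases hG.dist_eq_dist_add_one_of_adj o hadj with h | h
  · obtain ⟨j, hj⟩ := (hf (f v i)).1.2.2 v hadj.symm
    have := hR _ _ hadj.symm h j hj
    rwa [(hf v).1.2.1 this] at hj
  · exact hR _ _ hadj h i rfl

namespace IsEdgeColouring

variable {d : ℕ} {n n' : V → Fin d → V}

lemma foldl_reverse (hn : IsEdgeColouring G n) (w : List (Fin d)) (x : V) :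
    (w.reverse).foldl n (w.foldl n x) = x := by
  induction w generalizing x with
  | nil => rfl
  | cons i w ih => simp [ih, hn.invol]

lemma exists_foldl (hn : IsEdgeColouring G n) (hG : G.Connected) (x v : V) :
    ∃ w : List (Fin d), w.foldl n x = v := by
  obtain ⟨p⟩ := hG x v
  induction p with
  | nil => exact ⟨[], rfl⟩
  | @cons u y z h p ih =>
    obtain ⟨w, hw⟩ := ih
    obtain ⟨i, rfl⟩ := hn.surj _ _ h
    exact ⟨i :: w, hw⟩

/-- Words in the colours act through a free product of copies of ℤ/2. Cancelling `i :: i` changes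
neither endpoint, and a nonempty word without such a factor traces a non-backtracking walk, which
cannot close up in a tree. So being closed is a property of the word alone. -/
lemma foldl_eq_of_closed (hG : G.IsTree) (hn : IsEdgeColouring G n) (hn' : IsEdgeColouring G n')
    (x y : V) (w : List (Fin d)) (h : w.foldl n x = x) : w.foldl n' y = y := by
  induction hl : w.length using Nat.strong_induction_on generalizing w with
  | _ l ih =>
  subst hl
  by_cases hw : w = []
  · subst hw; rfl
  by_cases hb : ∃ (a b : List (Fin d)) (i : Fin d), w = a ++ i :: i :: b
  · obtain ⟨a, b, i, rfl⟩ := hb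
    have := ih (a ++ b).length (by simp) (a ++ b) (by simpa [hn.invol] using h) rfl
    simpa [hn'.invol] using this
  · exfalso
    push Not at hb
    have hsucc : ∀ i (hi : i < w.length),
        (w.take (i + 1)).foldl n x = n ((w.take i).foldl n x) w[i] := by
      intro i hi
      rw [List.take_add_one, List.foldl_append]
      simp [hi]
    have := dist_of_nonbacktracking hG (fun i => (w.take i).foldl n x) w.length
      (fun i hi => by
        simp only [hsucc i hi]
        exact hn.adj _ _)
      (fun i hi heq => by
        have h1 := hsucc i (by omega)
        have h2 := hsucc (i + 1) hi
        rw [h2, ← hn.invol ((w.take i).foldl n x) w[i], ← h1] at heq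
        have h3 := hn.inj _ heq
        apply hb (w.take i) (w.drop (i + 2)) w[i]
        conv_lhs => rw [← List.take_append_drop i w]
        rw [List.drop_eq_getElem_cons (by omega), List.drop_eq_getElem_cons (i := i + 1) hi, ← h3])
    simp only [List.take_zero, List.foldl_nil, List.take_length, h, SimpleGraph.dist_self] at this
    exact hw (List.length_eq_zero_iff.1 this.symm)

lemma foldl_eq_foldl (hG : G.IsTree) (hn : IsEdgeColouring G n) (hn' : IsEdgeColouring G n')
    (x y : V) {w w' : List (Fin d)} (h : w.foldl n x = w'.foldl n x) :
    w.foldl n' y = w'.foldl n' y := by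
  have h1 := foldl_eq_of_closed hG hn hn' x y (w ++ w'.reverse)
    (by rw [List.foldl_append, h, hn.foldl_reverse])
  have h2 := hn'.foldl_reverse w'.reverse (w.foldl n' y)
  rw [List.foldl_append] at h1
  rw [h1, List.reverse_reverse] at h2
  exact h2.symm

/-- Coloured regular trees are homogeneous. -/
lemma exists_iso (hG : G.IsTree) (hn : IsEdgeColouring G n) (hn' : IsEdgeColouring G n')
    (x y : V) : ∃ γ : G ≃g G, γ x = y ∧ ∀ v i, γ (n v i) = n' (γ v) i := by
  choose w hw using hn.exists_foldl hG.connected x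
  choose w' hw' using hn'.exists_foldl hG.connected y
  have hf : ∀ v i, (w (n v i)).foldl n' y = n' ((w v).foldl n' y) i := by
    intro v i
    have : (w (n v i)).foldl n x = (w v ++ [i]).foldl n x := by simp [hw]
    simpa using foldl_eq_foldl hG hn hn' x y this
  have hg : ∀ v i, (w' (n' v i)).foldl n x = n ((w' v).foldl n x) i := by
    intro v i
    have : (w' (n' v i)).foldl n' y = (w' v ++ [i]).foldl n' y := by simp [hw']
    simpa using foldl_eq_foldl hG hn' hn y x this
  let e : V ≃ V :=
    { toFun := fun v => (w v).foldl n' y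
      invFun := fun v => (w' v).foldl n x
      left_inv := fun v => by
        have : (w' ((w v).foldl n' y)).foldl n' y = (w v).foldl n' y := hw' _
        beta_reduce
        rw [foldl_eq_foldl hG hn' hn y x this, hw]
      right_inv := fun v => by
        have : (w ((w' v).foldl n x)).foldl n x = (w' v).foldl n x := hw _
        beta_reduce
        rw [foldl_eq_foldl hG hn hn' x y this, hw'] }
  refine ⟨⟨e, ?_⟩, ?_, hf⟩
  · intro a b
    constructor
    · intro h
      obtain ⟨i, hi⟩ := hn'.surj _ _ h
      have h1 := hg (e a) i
      rw [hi] at h1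
      have h2 : e.symm (e b) = n (e.symm (e a)) i := h1
      rw [e.symm_apply_apply, e.symm_apply_apply] at h2
      rw [h2]; exact hn.adj _ _
    · intro h
      obtain ⟨i, rfl⟩ := hn.surj _ _ h
      have : e (n a i) = n' (e a) i := hf a i
      rw [this]; exact hn'.adj _ _
  · have : (w x).foldl n x = ([] : List (Fin d)).foldl n x := hw x
    exact foldl_eq_foldl hG hn hn' x y this

lemma iso_ext (hG : G.Connected) (hn : IsEdgeColouring G n) {γ δ : G ≃g G}
    (hγ : ∀ v i, γ (n v i) = n (γ v) i) (hδ : ∀ v i, δ (n v i) = n (δ v) i) {x : V}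
    (h : γ x = δ x) (v : V) : γ v = δ v := by
  obtain ⟨w, rfl⟩ := hn.exists_foldl hG x v
  induction w using List.reverseRecOn with
  | nil => exact h
  | append_singleton w i ih => simp [hγ, hδ, ih]

end IsEdgeColouring

section Regular

variable [G.LocallyFinite] {d : ℕ}

/-- A bijection of the vertices that witnesses the mass transport principle at `o`. -/
lemma exists_transport (hG : G.IsTree) (hd : 0 < d) (hreg : G.IsRegularOfDegree d) (o : V) :
    ∃ e : V ≃ V, ∀ v, ∃ γ : G ≃g G, γ v = o ∧ γ o = e v := by
  obtain ⟨n, hn, -⟩ := exists_edgeColouring hG hreg ⟨0, hd⟩ id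
  choose γ hγ hγn using fun v => hn.exists_iso hG hn v o
  -- The composite preserves colours and fixes `o`, so it is the identity; hence `v ↦ γ v o` is an
  -- involution.
  have hinv : ∀ v w, γ (γ v o) (γ v w) = w := by
    intro v w
    refine hn.iso_ext hG.connected (γ := (γ v).trans (γ (γ v o))) (δ := RelIso.refl _) (x := o)
      ?_ (fun _ _ => rfl) ?_ w
    · intro u i; simp [hγn]
    · simp [hγ]
  refine ⟨⟨fun v => γ v o, fun v => γ v o, fun v => ?_, fun v => ?_⟩, fun v => ⟨γ v, hγ v, rfl⟩⟩
  · have := hinv v v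
    rwa [hγ] at this
  · have := hinv v v
    rwa [hγ] at this

lemma exists_iso_partner (hG : G.IsTree) (hd : 0 < d) (hreg : G.IsRegularOfDegree d) (o : V)
    {m m' : V → V} (hm : IsPartner G m) (hm' : IsPartner G m') :
    ∃ γ : G ≃g G, γ o = o ∧ ∀ v, γ (m v) = m' (γ v) := by
  obtain ⟨n, hn, h⟩ := exists_edgeColouring hG hreg ⟨0, hd⟩ m
  obtain ⟨n', hn', h'⟩ := exists_edgeColouring hG hreg ⟨0, hd⟩ m'
  obtain ⟨γ, h1, h2⟩ := hn.exists_iso hG hn' o o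
  exact ⟨γ, h1, fun v => by rw [← h hm, h2, h' hm']⟩

end Regular

end Tree

/-! ### Perfect matchings as involutions and as configurations -/

section PerfectMatchings

variable {V : Type*} {G : SimpleGraph V}

lemma mem_perfectMatchings_iff (ω : Config G) : ω ∈ perfectMatchings G ↔
    ∃ m, IsPartner G m ∧ ∀ e : G.edgeSet, ω e = true ↔ ∃ v, (e : Sym2 V) = s(v, m v) := by
  constructor
  · rintro ⟨M, ⟨hM, hs⟩, hω⟩
    choose m hm hmu using fun v => hM (hs v)
    refine ⟨m, ⟨fun v => (hm v).adj_sub, fun v => (hmu (m v) v (hm v).symm).symm⟩, fun e => ?_⟩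
    rw [hω]
    obtain ⟨e, he⟩ := e
    induction e with
    | h a b =>
      simp only [SimpleGraph.Subgraph.mem_edgeSet]
      constructor
      · intro h
        exact ⟨a, by rw [hmu a b h]⟩
      · rintro ⟨v, hv⟩
        rw [Sym2.eq_iff] at hv
        rcases hv with ⟨rfl, rfl⟩ | ⟨rfl, rfl⟩
        · exact hm _
        · exact (hm _).symm
  · rintro ⟨m, hm, hω⟩
    refine ⟨⟨Set.univ, fun a b => b = m a, ?_, by simp, ?_⟩, ⟨?_, ?_⟩, ?_⟩
    · rintro a b rfl; exact hm.adj a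
    · constructor; rintro a b rfl; exact (hm.invol a).symm
    · intro v _; exact ⟨m v, rfl, fun y h => h⟩
    · intro v; trivial
    · intro e
      rw [hω]
      obtain ⟨e, he⟩ := e
      induction e with
      | h a b =>
        simp only [SimpleGraph.Subgraph.mem_edgeSet]
        constructor
        · rintro ⟨v, hv⟩
          rw [Sym2.eq_iff] at hv
          rcases hv with ⟨rfl, rfl⟩ | ⟨rfl, rfl⟩
          · rfl
          · exact (hm.invol _).symm
        · rintro rfl; exact ⟨a, rfl⟩

lemma eq_true_iff_of_mem_perfectMatchings {ω : Config G} (h : ω ∈ perfectMatchings G) {v p : V}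
    (hp : G.Adj v p) : ω ⟨s(v, p), hp⟩ = true ↔
      ∀ w (hw : G.Adj v w), w ≠ p → ω ⟨s(v, w), hw⟩ = false := by
  obtain ⟨m, hm, hω⟩ := (mem_perfectMatchings_iff ω).1 h
  have key : ∀ w (hw : G.Adj v w), ω ⟨s(v, w), hw⟩ = true ↔ w = m v := by
    intro w hw
    rw [hω]
    constructor
    · rintro ⟨u, hu⟩
      simp only [Sym2.eq_iff] at hu
      rcases hu with ⟨rfl, rfl⟩ | ⟨rfl, rfl⟩
      · rfl
      · exact (hm.invol _).symm
    · rintro rfl; exact ⟨v, rfl⟩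
  constructor
  · intro h1 w hw hne
    rw [← Bool.not_eq_true, key]
    rw [key] at h1
    rintro rfl; exact hne h1.symm
  · intro h1
    rw [key]
    by_contra hne
    have := h1 (m v) (hm.adj v) (fun h => hne h.symm)
    rw [← Bool.not_eq_true, key] at this
    exact this rfl

end PerfectMatchings

/-! ### Fullness of the tail field -/

section Tail

variable {V : Type*} {G : SimpleGraph V}

lemma sigmaField_le (K : Set G.edgeSet) : sigmaField G K ≤ MeasurableSpace.pi :=
  iSup₂_le fun e _ => le_iSup (fun e => MeasurableSpace.comap (fun ω : Config G => ω e) _) e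

lemma sigmaField_mono {K L : Set G.edgeSet} (h : K ⊆ L) : sigmaField G K ≤ sigmaField G L :=
  biSup_mono h

lemma ballEdges_mono (o : V) : Monotone (ballEdges G o) :=
  fun _ _ hrs _ he v hv => (he v hv).trans hrs

lemma measurable_eval_sigmaField {K : Set G.edgeSet} {e : G.edgeSet} (he : e ∈ K) :
    Measurable[sigmaField G K] (fun ω : Config G => ω e) :=
  (comap_measurable _).mono (le_iSup₂_of_le e he le_rfl) le_rfl

/-- A perfect matching of a tree is determined by its edges outside a ball. -/
lemma comap_sigmaField_eq [G.LocallyFinite] (hG : G.IsTree) (o : V) (r : ℕ) :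
    (sigmaField G (ballEdges G o r)ᶜ).comap (Subtype.val : perfectMatchings G → Config G) =
      Subtype.instMeasurableSpace := by
  apply le_antisymm (MeasurableSpace.comap_mono (sigmaField_le _))
  induction r with
  | zero =>
    refine MeasurableSpace.comap_mono (iSup_le fun e => ?_)
    refine le_iSup₂_of_le e ?_ le_rfl
    obtain ⟨e, he⟩ := e
    induction e with
    | h a b =>
      intro h
      have ha := h a (by simp)
      have hb := h b (by simp)
      simp only [nonpos_iff_eq_zero, hG.connected.dist_eq_zero_iff] at ha hb
      exact he.ne (ha.symm.trans hb)
  | succ r ih =>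
    refine ih.trans ?_
    rw [sigmaField, MeasurableSpace.comap_iSup]
    refine iSup_le fun e => ?_
    rw [MeasurableSpace.comap_iSup]
    refine iSup_le fun he => ?_
    rw [MeasurableSpace.comap_comp, ← measurable_iff_comap_le]
    have hout : ∀ e' ∈ (ballEdges G o (r + 1))ᶜ,
        Measurable[(sigmaField G (ballEdges G o (r + 1))ᶜ).comap
          (Subtype.val : perfectMatchings G → Config G)]
          (fun ω : perfectMatchings G => ω.1 e') := fun e' he' =>
      (measurable_eval_sigmaField he').comp (comap_measurable _)
    by_cases he' : e ∈ (ballEdges G o (r + 1))ᶜ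
    · exact hout e he'
    · obtain ⟨e, hadj⟩ := e
      -- The edge lies in the ball of radius `r + 1` but not in that of radius `r`, so an endpoint
      -- `v` is at distance `r + 1`, and `p` is then its parent. All other edges at `v` leave the
      -- larger ball.
      have hex : ∃ v p, e = s(v, p) ∧ r < G.dist o v := by
        simp only [ballEdges, Set.mem_compl_iff, Set.mem_ofPred_eq, not_forall] at he
        obtain ⟨v, hv, hr⟩ := he
        obtain ⟨p, rfl⟩ := Sym2.mem_iff_exists.1 hv
        exact ⟨v, p, rfl, by omega⟩
      obtain ⟨v, p, rfl, hv⟩ := hex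
      have hadj' : G.Adj v p := hadj
      simp only [ballEdges, Set.mem_compl_iff, not_not, Set.mem_ofPred_eq] at he'
      have h1 := he' v (by simp)
      have h2 := he' p (by simp)
      have h3 := hG.dist_eq_dist_add_one_of_adj o hadj'
      refine @measurable_to_bool _ (_) _ ?_
      have : (fun ω : perfectMatchings G => ω.1 ⟨s(v, p), hadj⟩) ⁻¹' {true} =
          ⋂ w : G.neighborSet v, {ω : perfectMatchings G | w.1 ≠ p →
            ω.1 ⟨s(v, w.1), w.2⟩ = false} := by
        ext ω
        simp only [Set.mem_preimage, Set.mem_singleton_iff, Set.mem_iInter, Set.mem_ofPred_eq]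
        rw [eq_true_iff_of_mem_perfectMatchings ω.2 hadj']
        exact ⟨fun h w => h w.1 w.2, fun h w hw => h ⟨w, hw⟩⟩
      simp only [Function.comp_def]
      rw [this]
      refine @MeasurableSet.iInter _ (_) _ _ _ fun w => ?_
      by_cases hwp : w.1 = p
      · simp [hwp]
      · simp only [ne_eq, hwp, not_false_eq_true, forall_const]
        refine hout ⟨s(v, w.1), w.2⟩ (fun hmem => ?_) (measurableSet_singleton false)
        have h4 := hmem w.1 (by simp)
        have h5 := hG.dist_eq_dist_add_one_of_adj o w.2
        exact hwp (eq_of_adj_of_dist_lt hG o w.2 hadj' (by omega) (by omega))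

/-- Each `r` yields its own set with trace `A`, measurable off the ball of radius `r`. Their limit
superior is unchanged when finitely many terms are dropped, so it is a tail event, and its trace is
still `A`. -/
lemma comap_tailField_eq [G.LocallyFinite] (hG : G.IsTree) (o : V) :
    (tailField G o).comap (Subtype.val : perfectMatchings G → Config G) =
      Subtype.instMeasurableSpace := by
  apply le_antisymm
  · exact MeasurableSpace.comap_mono ((iInf_le _ 0).trans (sigmaField_le _))
  · intro A hA
    have : ∀ r, ∃ B, MeasurableSet[sigmaField G (ballEdges G o r)ᶜ] B ∧ Subtype.val ⁻¹' B = A := by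
      intro r
      rw [← comap_sigmaField_eq hG o r] at hA
      exact hA
    choose B hB hBA using this
    refine ⟨⋂ n, ⋃ r, B (n + r), ?_, ?_⟩
    · rw [MeasurableSpace.measurableSet_iInf]
      intro k
      have : ⋂ n, ⋃ r, B (n + r) = ⋂ n, ⋃ r, B (k + n + r) := by
        apply Set.Subset.antisymm
        · intro x hx
          simp only [Set.mem_iInter, Set.mem_iUnion] at hx ⊢
          exact fun n => hx (k + n)
        · intro x hx
          simp only [Set.mem_iInter, Set.mem_iUnion] at hx ⊢
          intro n
          obtain ⟨r, hr⟩ := hx n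
          exact ⟨k + r, by rwa [← add_assoc, add_comm n k]⟩
      rw [this]
      refine @MeasurableSet.iInter _ (_) _ _ _ fun n => @MeasurableSet.iUnion _ (_) _ _ _ fun r => ?_
      exact sigmaField_mono (Set.compl_subset_compl.2 (ballEdges_mono o (by omega))) _ (hB _)
    · simp only [Set.preimage_iInter, Set.preimage_iUnion, hBA, Set.iUnion_const,
        Set.iInter_const]

lemma hasFullTail [G.LocallyFinite] (hG : G.IsTree) (o : V) {μ : Measure (Config G)}
    (h : ∀ᵐ ω ∂μ, ω ∈ perfectMatchings G) : HasFullTail G o μ := by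
  intro A hA
  have h1 : MeasurableSet[Subtype.instMeasurableSpace]
      ((Subtype.val : perfectMatchings G → Config G) ⁻¹' A) := ⟨A, hA, rfl⟩
  rw [← comap_tailField_eq hG o] at h1
  obtain ⟨B, hB, hBA⟩ := h1
  refine ⟨B, hB, ?_⟩
  filter_upwards [h] with ω hω
  exact propext (Set.ext_iff.1 hBA ⟨ω, hω⟩).symm

end Tail

/-! ### Finite balls and the action of automorphisms on them -/

section Balls

variable {V : Type*} {G : SimpleGraph V}

lemma finite_ball [G.LocallyFinite] (hG : G.Connected) (o : V) (r : ℕ) :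
    {v | G.dist o v ≤ r}.Finite := by
  induction r with
  | zero =>
    refine (Set.finite_singleton o).subset fun v hv => ?_
    simpa [hG.dist_eq_zero_iff, eq_comm] using hv
  | succ r ih =>
    refine (ih.union (ih.biUnion fun v _ => Set.toFinite (G.neighborSet v))).subset fun v hv => ?_
    by_cases hvo : v = o
    · subst hvo; left; simp
    · obtain ⟨p, hp, hd⟩ := exists_adj_dist_add_one hG o hvo
      right
      have hv' : G.dist o v ≤ r + 1 := hv
      exact Set.mem_biUnion (x := p) (show G.dist o p ≤ r by omega) hp

lemma countable_vertices [G.LocallyFinite] (hG : G.Connected) : Countable V := by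
  obtain ⟨o⟩ := hG.nonempty
  rw [← Set.countable_univ_iff]
  refine (Set.countable_iUnion fun r => (finite_ball hG o r).countable).mono fun v _ => ?_
  exact Set.mem_iUnion.2 ⟨G.dist o v, le_refl (G.dist o v)⟩

lemma finite_ballEdges [G.LocallyFinite] (hG : G.Connected) (o : V) (r : ℕ) :
    (ballEdges G o r).Finite := by
  have h := finite_ball hG o r
  refine Set.Finite.of_finite_image (f := Subtype.val) ?_ Subtype.val_injective.injOn
  refine ((h.prod h).image (fun p : V × V => s(p.1, p.2))).subset ?_
  rintro _ ⟨⟨e, he⟩, hmem, rfl⟩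
  induction e with
  | h a b => exact ⟨(a, b), ⟨hmem a (by simp), hmem b (by simp)⟩, rfl⟩

lemma exists_mem_ballEdges (o : V) (e : G.edgeSet) : ∃ r, e ∈ ballEdges G o r := by
  obtain ⟨e, he⟩ := e
  induction e with
  | h a b =>
    refine ⟨max (G.dist o a) (G.dist o b), fun v hv => ?_⟩
    rcases Sym2.mem_iff.1 hv with rfl | rfl
    · exact le_max_left _ _
    · exact le_max_right _ _

lemma dist_iso (γ : G ≃g G) (a b : V) : G.dist (γ a) (γ b) = G.dist a b := by
  have key : ∀ (γ : G ≃g G) (a b : V), G.Reachable a b → G.dist (γ a) (γ b) ≤ G.dist a b := by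
    intro γ a b h
    obtain ⟨w, hw⟩ := h.exists_walk_length_eq_dist
    rw [← hw, ← SimpleGraph.Walk.length_map γ.toHom w]
    exact SimpleGraph.dist_le _
  by_cases h : G.Reachable a b
  · apply le_antisymm (key γ a b h)
    simpa using key γ.symm (γ a) (γ b) (h.map γ.toHom)
  · have h' : ¬ G.Reachable (γ a) (γ b) := fun hh => h (by simpa using hh.map γ.symm.toHom)
    rw [SimpleGraph.dist_eq_zero_of_not_reachable h, SimpleGraph.dist_eq_zero_of_not_reachable h']

lemma mapEdgeSet_mem_ballEdges (γ : G ≃g G) {o : V} (h : γ o = o) {r : ℕ} {e : G.edgeSet}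
    (he : e ∈ ballEdges G o r) : γ.mapEdgeSet e ∈ ballEdges G o r := by
  obtain ⟨e, hadj⟩ := e
  induction e with
  | h a b =>
    have key : ∀ v, G.dist o (γ v) = G.dist o v := fun v => by
      conv_lhs => rw [← h]
      exact dist_iso γ o v
    intro v hv
    have hv' : v ∈ s(γ a, γ b) := hv
    rcases Sym2.mem_iff.1 hv' with rfl | rfl
    · rw [key]; exact he a (by simp)
    · rw [key]; exact he b (by simp)

lemma actConfig_eq_of_partner {η η' : Config G} {m m' : V → V} (γ : G ≃g G)
    (h : ∀ e : G.edgeSet, η e = true ↔ ∃ v, (e : Sym2 V) = s(v, m v))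
    (h' : ∀ e : G.edgeSet, η' e = true ↔ ∃ v, (e : Sym2 V) = s(v, m' v))
    (hγ : ∀ v, γ (m v) = m' (γ v)) : actConfig γ η = η' := by
  funext e
  rw [Bool.eq_iff_iff]
  unfold actConfig
  rw [h, h']
  obtain ⟨e, hadj⟩ := e
  induction e with
  | h a b =>
    constructor
    · rintro ⟨v, hv⟩
      refine ⟨γ v, ?_⟩
      have hv' : s(γ.symm a, γ.symm b) = s(v, m v) := hv
      have := congrArg (Sym2.map γ) hv'
      simpa [hγ] using this
    · rintro ⟨v, hv⟩
      refine ⟨γ.symm v, ?_⟩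
      have hv' : s(a, b) = s(v, m' v) := hv
      have := congrArg (Sym2.map γ.symm) hv'
      have h2 : γ.symm (m' v) = m (γ.symm v) := by
        rw [RelIso.symm_apply_eq, hγ, RelIso.apply_symm_apply]
      rw [Sym2.map_mk, Sym2.map_mk, h2] at this
      exact this

end Balls

/-! ### Uniqueness of the invariant law -/

section Uniqueness

variable {V : Type*} {G : SimpleGraph V}

lemma measurable_actConfig (γ : G ≃g G) : Measurable (actConfig γ) :=
  measurable_pi_lambda _ fun _ => measurable_pi_apply _

lemma measurable_domRestrict (K : Set G.edgeSet) :
    Measurable (K.domRestrict : Config G → K → Bool) :=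
  measurable_pi_lambda _ fun _ => measurable_pi_apply _

variable [G.LocallyFinite] {d : ℕ}

/-- An automorphism fixing `o` and carrying one matching to the other preserves the ball, so it
carries one cylinder to the other. -/
lemma measure_ball_cylinder_eq (hG : G.IsTree) (hd : 0 < d) (hreg : G.IsRegularOfDegree d) (o : V)
    (r : ℕ) {μ : Measure (Config G)} (hμ : IsInvariantMatchingLaw G μ) {η η' : Config G}
    (hη : η ∈ perfectMatchings G) (hη' : η' ∈ perfectMatchings G) :
    μ ((ballEdges G o r).domRestrict ⁻¹' {(ballEdges G o r).domRestrict η}) =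
      μ ((ballEdges G o r).domRestrict ⁻¹' {(ballEdges G o r).domRestrict η'}) := by
  obtain ⟨m, hm, h⟩ := (mem_perfectMatchings_iff η).1 hη
  obtain ⟨m', hm', h'⟩ := (mem_perfectMatchings_iff η').1 hη'
  obtain ⟨γ, hγo, hγ⟩ := exists_iso_partner hG hd hreg o hm hm'
  have hη' := actConfig_eq_of_partner γ h h' hγ
  have : Finite (ballEdges G o r) := finite_ballEdges hG.connected o r
  rw [← hη']
  refine Eq.trans ?_ ((hμ.invariant γ).measure_preimage
    (measurable_domRestrict _ (measurableSet_singleton _)).nullMeasurableSet)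
  congr 1
  have hsymm : γ.symm o = o := by rw [RelIso.symm_apply_eq, hγo]
  have hres : ∀ ω ω' : Config G, (ballEdges G o r).domRestrict ω = (ballEdges G o r).domRestrict ω' ↔
      ∀ e ∈ ballEdges G o r, ω e = ω' e := fun ω ω' =>
    ⟨fun h e he => congrFun h ⟨e, he⟩, fun h => funext fun e => h e.1 e.2⟩
  ext ω
  rw [Set.mem_preimage, Set.mem_singleton_iff, hres, Set.mem_preimage, Set.mem_preimage,
    Set.mem_singleton_iff, hres]
  constructor
  · intro hω e he
    exact hω _ (mapEdgeSet_mem_ballEdges γ.symm hsymm he)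
  · intro hω e he
    have h1 := hω _ (mapEdgeSet_mem_ballEdges γ hγo he)
    have h2 : γ.symm.mapEdgeSet (γ.mapEdgeSet e) = e := γ.mapEdgeSet.symm_apply_apply _
    simp only [actConfig] at h1
    rwa [h2] at h1

lemma map_restrict_ball_eq (hG : G.IsTree) (hd : 0 < d) (hreg : G.IsRegularOfDegree d) (o : V)
    (r : ℕ) {μ ν : Measure (Config G)} (hμ : IsInvariantMatchingLaw G μ)
    (hν : IsInvariantMatchingLaw G ν) :
    μ.map (ballEdges G o r).domRestrict = ν.map (ballEdges G o r).domRestrict := by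
  classical
  have : Finite (ballEdges G o r) := finite_ballEdges hG.connected o r
  have : Fintype (ballEdges G o r) := Fintype.ofFinite _
  have hmeas := measurable_domRestrict (ballEdges G o r)
  have := hμ.isProbabilityMeasure
  obtain ⟨η₀, hη₀⟩ := hμ.carried.exists
  set R : Config G → ballEdges G o r → Bool := (ballEdges G o r).domRestrict
  -- The patterns on the ball that extend to perfect matchings. Both marginals are uniform on this
  -- finite set, which does not depend on the measure.
  let S := Finset.univ.filter (fun s => s ∈ R '' perfectMatchings G)
  have key : ∀ μ : Measure (Config G), IsInvariantMatchingLaw G μ →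
      (∀ s, μ.map R {s} = if s ∈ S then μ.map R {R η₀} else 0) ∧
        S.card * μ.map R {R η₀} = 1 := by
    intro μ hμ
    have := hμ.isProbabilityMeasure
    have h1 : ∀ s, μ.map R {s} = if s ∈ S then μ.map R {R η₀} else 0 := by
      intro s
      rw [Measure.map_apply hmeas (measurableSet_singleton _),
        Measure.map_apply hmeas (measurableSet_singleton _)]
      split_ifs with hs
      · obtain ⟨η, hη, rfl⟩ := (Finset.mem_filter.1 hs).2
        exact measure_ball_cylinder_eq hG hd hreg o r hμ hη hη₀
      · refine measure_mono_null (t := {ω | ¬ ω ∈ perfectMatchings G})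
          (fun ω hω hω' => hs ?_) (ae_iff.1 hμ.carried)
        exact Finset.mem_filter.2 ⟨Finset.mem_univ _, ω, hω', hω⟩
    refine ⟨h1, ?_⟩
    have : IsProbabilityMeasure (μ.map R) := Measure.isProbabilityMeasure_map hmeas.aemeasurable
    have h2 : ∑ s, μ.map R {s} = 1 := by
      rw [sum_measure_singleton, Finset.coe_univ, measure_univ]
    rw [Finset.sum_congr rfl fun s _ => h1 s, Finset.sum_ite_mem, Finset.univ_inter,
      Finset.sum_const, nsmul_eq_mul] at h2
    exact h2
  obtain ⟨h1, h2⟩ := key μ hμ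
  obtain ⟨h3, h4⟩ := key ν hν
  have hc : μ.map R {R η₀} = ν.map R {R η₀} := by
    have h0 : (S.card : ENNReal) ≠ 0 := by
      intro h; rw [h, zero_mul] at h2; exact zero_ne_one h2
    exact (ENNReal.mul_right_inj h0 (ENNReal.natCast_ne_top _)).1 (h2.trans h4.symm)
  refine Measure.ext_of_singleton fun s => ?_
  rw [h1, h3, hc]

lemma IsInvariantMatchingLaw.unique (hG : G.IsTree) (hd : 0 < d) (hreg : G.IsRegularOfDegree d)
    {μ ν : Measure (Config G)} (hμ : IsInvariantMatchingLaw G μ)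
    (hν : IsInvariantMatchingLaw G ν) : μ = ν := by
  obtain ⟨o⟩ := hG.connected.nonempty
  have := hμ.isProbabilityMeasure
  have := hν.isProbabilityMeasure
  refine IsProjectiveLimit.unique (P := fun I => μ.map I.restrict) (fun I => rfl) fun I => ?_
  have hI : ∃ r, (I : Set G.edgeSet) ⊆ ballEdges G o r := by
    choose r hr using exists_mem_ballEdges (G := G) o
    exact ⟨I.sup r, fun e he => ballEdges_mono o (Finset.le_sup he) (hr e)⟩
  obtain ⟨r, hr⟩ := hI
  have h1 := congrArg (Measure.map fun (s : ballEdges G o r → Bool) (e : I) => s ⟨e, hr e.2⟩)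
    (map_restrict_ball_eq hG hd hreg o r hμ hν)
  have h2 : Measurable fun (s : ballEdges G o r → Bool) (e : I) => s ⟨e, hr e.2⟩ :=
    measurable_pi_lambda _ fun e => measurable_pi_apply _
  rw [Measure.map_map h2 (measurable_domRestrict _),
    Measure.map_map h2 (measurable_domRestrict _)] at h1
  exact h1.symm

end Uniqueness

/-! ### Mass transport and the averaging operator on equivariant fields -/

section Labels

variable {V : Type*} {G : SimpleGraph V}

instance : IsProbabilityMeasure (iidLaw V) := by unfold iidLaw; infer_instance

lemma measurePreserving_actLabels (γ : G ≃g G) :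
    MeasurePreserving (actLabels γ) (iidLaw V) (iidLaw V) := by
  refine ⟨measurable_pi_lambda _ fun _ => measurable_pi_apply _, ?_⟩
  have h := Measure.infinitePi_map_piCongrLeft
    (μ := fun _ : V => (volume : Measure unitInterval)) γ.toEquiv
  have h2 : (actLabels γ : Labels V → Labels V) =
      MeasurableEquiv.piCongrLeft (fun _ : V => unitInterval) γ.toEquiv := by
    funext ω x
    obtain ⟨y, rfl⟩ := γ.toEquiv.surjective x
    rw [MeasurableEquiv.coe_piCongrLeft, Equiv.piCongrLeft_apply_apply]
    simp [actLabels]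
  rw [h2]
  exact h

lemma actLabels_symm_actLabels (γ : G ≃g G) (ω : Labels V) :
    actLabels γ.symm (actLabels γ ω) = ω := by
  funext x; simp [actLabels]

/-- The mass transport principle. -/
lemma tsum_transport [G.LocallyFinite] {d : ℕ} (hG : G.IsTree) (hd : 0 < d)
    (hreg : G.IsRegularOfDegree d) (o : V) {α : Type*} [AddCommMonoid α] [TopologicalSpace α]
    (F : V → V → α) (hF : ∀ (γ : G ≃g G) x y, F (γ x) (γ y) = F x y) :
    ∑' v, F o v = ∑' v, F v o := by
  obtain ⟨e, he⟩ := exists_transport hG hd hreg o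
  rw [← e.tsum_eq (fun v => F v o)]
  refine tsum_congr fun v => ?_
  obtain ⟨γ, h1, h2⟩ := he v
  rw [← hF γ, h1, h2]

lemma exists_iso_apply_eq [G.LocallyFinite] {d : ℕ} (hG : G.IsTree) (hd : 0 < d)
    (hreg : G.IsRegularOfDegree d) (o v : V) : ∃ γ : G ≃g G, γ o = v := by
  obtain ⟨e, he⟩ := exists_transport hG hd hreg o
  obtain ⟨γ, h1, -⟩ := he v
  exact ⟨γ.symm, by rw [RelIso.symm_apply_eq, h1]⟩

/-- Average of a function over the neighbours of a vertex. -/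
noncomputable def nbrAvg (G : SimpleGraph V) [G.LocallyFinite] (c : V → ℝ) : V → ℝ :=
  fun x => (∑ y ∈ G.neighborFinset x, c y) / G.degree x

/-- Away from the root, one neighbour has weight 3/2 times that of `x` and the other `d - 1` have
2/3 times it. The resulting factor 2/3 + 5/(6d) equals 17/18 at d = 3 and decreases in d; at the
root the factor is only 2/3. -/
lemma nbrAvg_weight_le [G.LocallyFinite] {d : ℕ} (hG : G.IsTree) (hd : 3 ≤ d)
    (hreg : G.IsRegularOfDegree d) (o x : V) :
    nbrAvg G (fun y => (2 / 3 : ℝ) ^ G.dist o y) x ≤ 17 / 18 * (2 / 3) ^ G.dist o x := by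
  classical
  have hd' : (3 : ℝ) ≤ d := by exact_mod_cast hd
  unfold nbrAvg
  rw [hreg x, div_le_iff₀ (by linarith)]
  by_cases hx : x = o
  · subst hx
    have : ∀ y ∈ G.neighborFinset x, (2 / 3 : ℝ) ^ G.dist x y = 2 / 3 := by
      intro y hy
      rw [SimpleGraph.mem_neighborFinset] at hy
      rw [SimpleGraph.dist_eq_one_iff_adj.2 hy, pow_one]
    rw [Finset.sum_congr rfl this, Finset.sum_const, SimpleGraph.card_neighborFinset_eq_degree,
      hreg x]
    simp
    linarith
  · obtain ⟨p, hp, hpd⟩ := exists_adj_dist_add_one hG.connected o hx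
    have hmem : p ∈ G.neighborFinset x := by simpa using hp.symm
    rw [← Finset.add_sum_erase _ _ hmem]
    have : ∀ y ∈ (G.neighborFinset x).erase p,
        (2 / 3 : ℝ) ^ G.dist o y = (2 / 3) ^ (G.dist o x + 1) := by
      intro y hy
      rw [Finset.mem_erase, SimpleGraph.mem_neighborFinset] at hy
      congr 1
      rcases hG.dist_eq_dist_add_one_of_adj o hy.2 with h | h
      · exact absurd (eq_of_adj_of_dist_lt hG o hy.2 hp.symm (by omega) (by omega)) hy.1
      · exact h
    rw [Finset.sum_congr rfl this, Finset.sum_const, Finset.card_erase_of_mem hmem,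
      SimpleGraph.card_neighborFinset_eq_degree, hreg x, nsmul_eq_mul, hpd,
      Nat.cast_sub (by omega)]
    have : (0 : ℝ) < (2 / 3) ^ G.dist o p := by positivity
    rw [pow_succ, pow_succ]
    push_cast
    nlinarith

lemma nbrAvg_mono [G.LocallyFinite] {c c' : V → ℝ} (h : ∀ x, c x ≤ c' x) (x : V) :
    nbrAvg G c x ≤ nbrAvg G c' x :=
  div_le_div_of_nonneg_right (Finset.sum_le_sum fun y _ => h y) (by positivity)

lemma nbrAvg_const_mul [G.LocallyFinite] (C : ℝ) (c : V → ℝ) (x : V) :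
    nbrAvg G (fun y => C * c y) x = C * nbrAvg G c x := by
  simp only [nbrAvg]
  rw [← Finset.mul_sum, mul_div_assoc]

lemma iterate_nbrAvg_le [G.LocallyFinite] {d : ℕ} (hG : G.IsTree) (hd : 3 ≤ d)
    (hreg : G.IsRegularOfDegree d) (o : V) {c : V → ℝ} {C : ℝ} (hC : 0 ≤ C)
    (hc : ∀ x, c x ≤ C * (2 / 3) ^ G.dist o x) (n : ℕ) (x : V) :
    ((nbrAvg G)^[n] c) x ≤ (C * (17 / 18) ^ n) * (2 / 3) ^ G.dist o x := by
  induction n generalizing x with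
  | zero => simpa using hc x
  | succ n ih =>
    rw [Function.iterate_succ_apply']
    refine (nbrAvg_mono ih x).trans ?_
    rw [nbrAvg_const_mul]
    calc _ ≤ C * (17 / 18) ^ n * (17 / 18 * (2 / 3) ^ G.dist o x) := by
          gcongr
          exact nbrAvg_weight_le hG hd hreg o x
      _ = _ := by ring

/-- A square-integrable real field on the vertices, almost surely equivariant. -/
structure IsField (G : SimpleGraph V) (f : V → Labels V → ℝ) : Prop where
  memLp : ∀ x, MemLp (f x) 2 (iidLaw V)
  equivariant : ∀ (γ : G ≃g G) x, (fun ω => f (γ x) (actLabels γ ω)) =ᵐ[iidLaw V] f x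

/-- The average of a field over the neighbours. -/
noncomputable def avgField (G : SimpleGraph V) [G.LocallyFinite] (f : V → Labels V → ℝ) :
    V → Labels V → ℝ :=
  fun x ω => nbrAvg G (fun y => f y ω) x

namespace IsField

variable {f g : V → Labels V → ℝ}

lemma integrable_mul (hf : IsField G f) (hg : IsField G g) (x y : V) :
    Integrable (fun ω => f x ω * g y ω) (iidLaw V) :=
  (hf.memLp x).integrable_mul (hg.memLp y)

lemma integral_mul_apply (hf : IsField G f) (hg : IsField G g) (γ : G ≃g G) (x y : V) :
    ∫ ω, f (γ x) ω * g (γ y) ω ∂iidLaw V = ∫ ω, f x ω * g y ω ∂iidLaw V := by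
  have h := measurePreserving_actLabels (V := V) γ
  conv_lhs => rw [← h.map_eq]
  rw [integral_map h.measurable.aemeasurable
    (by rw [h.map_eq]; exact (hf.integrable_mul hg _ _).aestronglyMeasurable)]
  refine integral_congr_ae ?_
  filter_upwards [hf.equivariant γ x, hg.equivariant γ y] with ω h1 h2
  rw [h1, h2]

variable [G.LocallyFinite]

lemma avg (hf : IsField G f) : IsField G (avgField G f) where
  memLp x := by
    unfold avgField nbrAvg
    simp only [div_eq_mul_inv]
    exact (memLp_finsetSum _ fun y _ => hf.memLp y).mul_const _
  equivariant γ x := by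
    have : ∀ᵐ ω ∂iidLaw V, ∀ y ∈ G.neighborFinset x, f (γ y) (actLabels γ ω) = f y ω :=
      (Finset.eventually_all _).2 fun y _ => hf.equivariant γ y
    filter_upwards [this] with ω hω
    unfold avgField nbrAvg
    have hmap : G.neighborFinset (γ x) = (G.neighborFinset x).map γ.toEquiv.toEmbedding := by
      ext y
      obtain ⟨y, rfl⟩ := γ.surjective y
      rw [SimpleGraph.mem_neighborFinset, SimpleGraph.Iso.map_adj_iff]
      constructor
      · exact fun h => Finset.mem_map.2 ⟨y, by simpa using h, rfl⟩
      · intro h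
        obtain ⟨z, hz, hzy⟩ := Finset.mem_map.1 h
        rw [← γ.injective hzy]
        simpa using hz
    have hdeg : G.degree (γ x) = G.degree x := by
      rw [← SimpleGraph.card_neighborFinset_eq_degree, hmap, Finset.card_map,
        SimpleGraph.card_neighborFinset_eq_degree]
    rw [hdeg, hmap, Finset.sum_map]
    congr 1
    exact Finset.sum_congr rfl fun y hy => hω y hy

lemma iterate_avgField (hf : IsField G f) (n : ℕ) : IsField G ((avgField G)^[n] f) := by
  induction n with
  | zero => exact hf
  | succ n ih => rw [Function.iterate_succ_apply']; exact ih.avg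

lemma integral_avgField_mul (hf : IsField G f) {h : Labels V → ℝ} (hh : MemLp h 2 (iidLaw V))
    (x : V) : ∫ ω, avgField G f x ω * h ω ∂iidLaw V =
      nbrAvg G (fun y => ∫ ω, f y ω * h ω ∂iidLaw V) x := by
  unfold avgField nbrAvg
  have hint : ∀ y ∈ G.neighborFinset x, Integrable (fun ω => f y ω * h ω) (iidLaw V) :=
    fun y _ => (hf.memLp y).integrable_mul hh
  beta_reduce
  rw [← integral_finsetSum _ hint, ← integral_div]
  refine integral_congr_ae (Filter.Eventually.of_forall fun ω => ?_)
  simp only [Finset.sum_mul, div_mul_eq_mul_div]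

lemma integral_iterate_avgField_mul (hf : IsField G f) {h : Labels V → ℝ}
    (hh : MemLp h 2 (iidLaw V)) (n : ℕ) (x : V) :
    ∫ ω, (avgField G)^[n] f x ω * h ω ∂iidLaw V =
      (nbrAvg G)^[n] (fun y => ∫ ω, f y ω * h ω ∂iidLaw V) x := by
  induction n generalizing x with
  | zero => rfl
  | succ n ih =>
    rw [Function.iterate_succ_apply', Function.iterate_succ_apply',
      (hf.iterate_avgField n).integral_avgField_mul hh]
    congr 1
    funext y
    exact ih y

/-- Self-adjointness of averaging. By invariance, the correlation of `f y` with `g x` over an edge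
is a mass sent from `x` to `y`, and the root sends as much as it receives. -/
lemma integral_avgField_mul_comm {d : ℕ} (hG : G.IsTree) (hd : 0 < d)
    (hreg : G.IsRegularOfDegree d) (o : V) (hf : IsField G f) (hg : IsField G g) :
    ∫ ω, avgField G f o ω * g o ω ∂iidLaw V =
      ∫ ω, f o ω * avgField G g o ω ∂iidLaw V := by
  classical
  rw [hf.integral_avgField_mul (hg.memLp o)]
  simp only [mul_comm (f o _)]
  rw [hg.integral_avgField_mul (hf.memLp o)]
  unfold nbrAvg
  congr 1
  have h := tsum_transport hG hd hreg o
    (fun x y => if G.Adj x y then ∫ ω, f y ω * g x ω ∂iidLaw V else 0) (fun γ x y => by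
      simp only [hf.integral_mul_apply hg, SimpleGraph.Iso.map_adj_iff])
  rw [tsum_eq_sum (s := G.neighborFinset o) (by simp +contextual),
    tsum_eq_sum (s := G.neighborFinset o) (by simp +contextual [SimpleGraph.adj_comm])] at h
  calc _ = _ := Finset.sum_congr rfl fun y hy => by
        rw [SimpleGraph.mem_neighborFinset] at hy; rw [if_pos hy]
    _ = _ := h
    _ = _ := Finset.sum_congr rfl fun y hy => by
        rw [SimpleGraph.mem_neighborFinset] at hy; rw [if_pos hy.symm]; simp only [mul_comm]

end IsField

/-- Cauchy–Schwarz from the discriminant of the nonnegative quadratic t ↦ ∫ (f + t g)². -/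
lemma sq_integral_mul_le {Ω : Type*} [MeasurableSpace Ω] {μ : Measure Ω} {f g : Ω → ℝ}
    (hf : MemLp f 2 μ) (hg : MemLp g 2 μ) :
    (∫ ω, f ω * g ω ∂μ) ^ 2 ≤ (∫ ω, f ω * f ω ∂μ) * ∫ ω, g ω * g ω ∂μ := by
  have key : ∀ t : ℝ, 0 ≤ (∫ ω, g ω * g ω ∂μ) * (t * t) + (2 * ∫ ω, f ω * g ω ∂μ) * t +
      ∫ ω, f ω * f ω ∂μ := by
    intro t
    have h : 0 ≤ ∫ ω, (f ω + t * g ω) * (f ω + t * g ω) ∂μ :=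
      integral_nonneg fun ω => mul_self_nonneg _
    have h1 : ∀ ω, (f ω + t * g ω) * (f ω + t * g ω) =
        (t * t) * (g ω * g ω) + (2 * t) * (f ω * g ω) + f ω * f ω := fun ω => by ring
    simp only [h1] at h
    have i1 : Integrable (fun ω => g ω * g ω) μ := hg.integrable_mul hg
    have i2 : Integrable (fun ω => f ω * g ω) μ := hf.integrable_mul hg
    have i3 : Integrable (fun ω => f ω * f ω) μ := hf.integrable_mul hf
    have i4 : Integrable (fun ω => t * t * (g ω * g ω) + 2 * t * (f ω * g ω)) μ :=
      (i1.const_mul _).add (i2.const_mul _)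
    rw [integral_add i4 i3, integral_add (i1.const_mul _) (i2.const_mul _), integral_const_mul, integral_const_mul] at h
    linarith
  have := discrim_le_zero key
  unfold discrim at this
  nlinarith

/-- A log-convex sequence that decays at rate `r` decreases by a factor `r` in its first step. -/
lemma le_mul_of_log_convex {s : ℕ → ℝ} {r C : ℝ} (hs : ∀ n, 0 ≤ s n)
    (hconv : ∀ n, s (n + 1) ^ 2 ≤ s n * s (n + 2)) (hr : 0 < r)
    (hdecay : ∀ n, s n ≤ C * r ^ n) : s 1 ≤ r * s 0 := by
  by_contra! hlt
  have h0 : 0 < s 0 := by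
    refine lt_of_le_of_ne (hs 0) fun h => ?_
    have := hconv 0
    rw [← h] at this hlt
    nlinarith
  set q := s 1 / s 0
  have hq : r < q := by rwa [lt_div_iff₀ h0]
  have hq0 : 0 < q := hr.trans hq
  have key : ∀ n, 0 < s n ∧ q * s n ≤ s (n + 1) := by
    intro n
    induction n with
    | zero => exact ⟨h0, by simp only [q]; rw [div_mul_cancel₀ _ h0.ne']⟩
    | succ n ih =>
      have h1 : 0 < s (n + 1) := lt_of_lt_of_le (mul_pos hq0 ih.1) ih.2
      refine ⟨h1, ?_⟩
      have h2 := hconv n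
      have h3 : q * s n * s (n + 1) ≤ s (n + 1) * s (n + 1) :=
        mul_le_mul_of_nonneg_right ih.2 h1.le
      have : s n * (q * s (n + 1)) ≤ s n * s (n + 2) := by nlinarith
      exact le_of_mul_le_mul_left this ih.1
  have hpow : ∀ n, s 0 * q ^ n ≤ s n := by
    intro n
    induction n with
    | zero => simp
    | succ n ih =>
      calc s 0 * q ^ (n + 1) = q * (s 0 * q ^ n) := by ring
        _ ≤ q * s n := by gcongr
        _ ≤ _ := (key n).2
  have hqr : 1 < q / r := by rwa [one_lt_div hr]
  obtain ⟨n, hn⟩ := pow_unbounded_of_one_lt (C / s 0) hqr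
  rw [div_pow, div_lt_div_iff₀ h0 (by positivity)] at hn
  have := (hpow n).trans (hdecay n)
  linarith [mul_comm (q ^ n) (s 0)]

/-- With T the averaging operator, sₙ = ‖Tⁿf‖² = ⟨T²ⁿf, f⟩ by self-adjointness. The correlations
with `f o` have finite range, so they are dominated by a multiple of the weight (2/3)^dist and sₙ =
O((17/18)²ⁿ). As sₙ is log-convex by Cauchy–Schwarz, the asymptotic rate already bounds its first
step, so the range `r` leaves no trace in the constant. -/
lemma IsField.integral_avgField_sq_le [G.LocallyFinite] {d : ℕ} (hG : G.IsTree) (hd : 3 ≤ d)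
    (hreg : G.IsRegularOfDegree d) (o : V) {f : V → Labels V → ℝ} (hf : IsField G f) (r : ℕ)
    (hr : ∀ x, r < G.dist o x → ∫ ω, f x ω * f o ω ∂iidLaw V = 0) :
    ∫ ω, avgField G f o ω * avgField G f o ω ∂iidLaw V ≤
      (17 / 18) ^ 2 * ∫ ω, f o ω * f o ω ∂iidLaw V := by
  have hd0 : 0 < d := by omega
  let T := avgField G
  have hT := hf.iterate_avgField
  have hmove : ∀ k n, ∫ ω, T^[n] f o ω * T^[n + k] f o ω ∂iidLaw V =
      ∫ ω, T^[n + n + k] f o ω * f o ω ∂iidLaw V := by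
    intro k n
    induction n generalizing k with
    | zero => simp [mul_comm]
    | succ n ih =>
      have := (hT n).integral_avgField_mul_comm hG hd0 hreg o (hT (n + 1 + k))
      rw [Function.iterate_succ_apply']
      refine this.trans ?_
      rw [← Function.iterate_succ_apply' (avgField G)]
      have h2 := ih (k + 2)
      rw [show (n + 1 + k).succ = n + (k + 2) by omega, show n + 1 + (n + 1) + k = n + n + (k + 2) by ring]
      exact h2
  obtain ⟨C, hC⟩ : ∃ C : ℝ, ∀ x, ∫ ω, f x ω * f o ω ∂iidLaw V ≤ C := by
    refine ⟨∫ ω, f o ω * f o ω ∂iidLaw V, fun x => ?_⟩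
    obtain ⟨γ, rfl⟩ := exists_iso_apply_eq hG hd0 hreg o x
    have h1 := sq_integral_mul_le (hf.memLp (γ o)) (hf.memLp o)
    rw [hf.integral_mul_apply hf] at h1
    have h2 : 0 ≤ ∫ ω, f o ω * f o ω ∂iidLaw V := integral_nonneg fun ω => mul_self_nonneg _
    exact le_of_abs_le (abs_le_of_sq_le_sq' (by rw [sq (∫ ω, f o ω * f o ω ∂iidLaw V)]; exact h1) h2
      |> abs_le.2)
  -- The factor (3/2)^r compensates for the smallest value of the weight (2/3)^dist within the range
  -- `r`.
  refine le_mul_of_log_convex (s := fun n => ∫ ω, T^[n] f o ω * T^[n] f o ω ∂iidLaw V)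
    (C := |C| * (3 / 2) ^ r) (fun n => integral_nonneg fun ω => mul_self_nonneg _) (fun n => ?_)
    (by norm_num) (fun n => ?_)
  · have h1 := hmove 2 n
    have h2 := hmove 0 (n + 1)
    simp only [add_zero] at h2
    rw [show n + 1 + (n + 1) = n + n + 2 by ring, ← h1] at h2
    simp only [h2]
    exact sq_integral_mul_le ((hT n).memLp o) ((hT (n + 2)).memLp o)
  · have h1 := hmove 0 n
    simp only [add_zero] at h1
    simp only [h1]
    rw [hf.integral_iterate_avgField_mul (hf.memLp o)]
    have := iterate_nbrAvg_le hG hd hreg o (c := fun x => ∫ ω, f x ω * f o ω ∂iidLaw V)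
      (C := |C| * (3 / 2) ^ r) (by positivity) (fun x => ?_) (n + n) o
    · simp only [SimpleGraph.dist_self, pow_zero, mul_one] at this
      refine this.trans (le_of_eq ?_)
      rw [← two_mul, pow_mul]
    · by_cases hx : r < G.dist o x
      · rw [hr x hx]; positivity
      · push Not at hx
        refine (hC x).trans ((le_abs_self C).trans ?_)
        rw [mul_assoc]
        refine le_mul_of_one_le_right (abs_nonneg _) ?_
        calc (1 : ℝ) = (3 / 2) ^ r * (2 / 3) ^ r := by rw [← mul_pow]; norm_num
          _ ≤ _ := by
            gcongr ?_ * ?_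
            exact pow_le_pow_of_le_one (by norm_num) (by norm_num) hx

end Labels

/-! ### Spectral gap for centred factors of IID -/

section SpectralGap

variable {V : Type*} {G : SimpleGraph V}

/-- The `σ`-field generated by the labels in a ball. -/
@[reducible] def ballSigma (G : SimpleGraph V) (x : V) (r : ℕ) : MeasurableSpace (Labels V) :=
  ⨆ v ∈ {v | G.dist x v ≤ r}, MeasurableSpace.comap (fun ω : Labels V => ω v) inferInstance

lemma ballSigma_le (x : V) (r : ℕ) : ballSigma G x r ≤ MeasurableSpace.pi :=
  iSup₂_le fun v _ => le_iSup (fun v => MeasurableSpace.comap (fun ω : Labels V => ω v) _) v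

lemma ballSigma_mono (x : V) : Monotone (ballSigma G x) :=
  fun _ _ h => biSup_mono fun _ hv => le_trans hv h

lemma iSup_ballSigma (x : V) : ⨆ r, ballSigma G x r = MeasurableSpace.pi := by
  apply le_antisymm (iSup_le fun r => ballSigma_le x r)
  exact iSup_le fun v => le_iSup_of_le (G.dist x v) (le_iSup₂_of_le v (le_refl (G.dist x v)) le_rfl)

lemma comap_actLabels_ballSigma (γ : G ≃g G) (x : V) (r : ℕ) :
    (ballSigma G (γ x) r).comap (actLabels γ) = ballSigma G x r := by
  simp only [ballSigma, MeasurableSpace.comap_iSup, MeasurableSpace.comap_comp]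
  apply le_antisymm
  · refine iSup₂_le fun v hv => le_iSup₂_of_le (γ.symm v) ?_ le_rfl
    have : G.dist (γ x) v ≤ r := hv
    rw [← RelIso.apply_symm_apply γ v, dist_iso] at this
    exact this
  · refine iSup₂_le fun v hv => le_iSup₂_of_le (γ v) ?_ (le_of_eq ?_)
    · have : G.dist x v ≤ r := hv
      rwa [← dist_iso γ] at this
    · congr 1
      funext ω
      simp [actLabels]

lemma indep_ballSigma (hG : G.Connected) {x y : V} {r : ℕ} (h : 2 * r < G.dist x y) :
    ProbabilityTheory.Indep (ballSigma G x r) (ballSigma G y r) (iidLaw V) := by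
  refine ProbabilityTheory.indep_iSup_of_disjoint
    (m := fun v => MeasurableSpace.comap (fun ω : Labels V => ω v) inferInstance)
    (fun v => le_iSup (fun v => MeasurableSpace.comap (fun ω : Labels V => ω v) _) v)
    (ProbabilityTheory.iIndepFun_infinitePi (P := fun _ : V => (volume : Measure unitInterval))
      (X := fun _ t => t) fun _ => measurable_id) ?_
  rw [Set.disjoint_left]
  intro v hv hv'
  have h1 : G.dist x v ≤ r := hv
  have h2 : G.dist y v ≤ r := hv'
  have h3 := hG.dist_triangle (u := x) (v := v) (w := y)
  rw [SimpleGraph.dist_comm (u := v)] at h3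
  omega

/-- The conditional expectation of a field given the labels in balls of radius `r`. -/
noncomputable def localField (G : SimpleGraph V) (r : ℕ) (f : V → Labels V → ℝ) :
    V → Labels V → ℝ :=
  fun x => (iidLaw V)[f x | ballSigma G x r]

/-- Conditional expectation is characterised by its integrals over the conditioning σ-field, and an
automorphism transports that σ-field, the measure and the field together. Uniqueness holds up to
null sets, which is why `IsField` asks only for almost sure equivariance. -/
lemma IsField.localField {f : V → Labels V → ℝ} (hf : IsField G f) (r : ℕ) :
    IsField G (localField G r f) where
  memLp x := (hf.memLp x).condExp (by norm_num)
  equivariant γ x := by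
    have hθ := measurePreserving_actLabels (V := V) γ
    have hint : ∀ x, Integrable (f x) (iidLaw V) := fun x => (hf.memLp x).integrable (by norm_num)
    have hle := ballSigma_le (G := G) (γ x) r
    have hchange : ∀ (g : Labels V → ℝ), Integrable g (iidLaw V) → ∀ t, MeasurableSet t →
        ∫ ω in actLabels γ ⁻¹' t, g (actLabels γ ω) ∂iidLaw V = ∫ ω in t, g ω ∂iidLaw V := by
      intro g hg t ht
      conv_rhs => rw [← hθ.map_eq]
      rw [setIntegral_map ht (by rw [hθ.map_eq]; exact hg.aestronglyMeasurable)
        hθ.measurable.aemeasurable]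
    refine ae_eq_condExp_of_forall_setIntegral_eq (ballSigma_le x r) (hint x) (fun s _ _ => ?_)
      (fun s hs _ => ?_) ?_
    · exact (hθ.integrable_comp_of_integrable integrable_condExp).integrableOn
    · rw [← comap_actLabels_ballSigma γ x r] at hs
      obtain ⟨t, ht, rfl⟩ := hs
      refine (hchange _ integrable_condExp t (hle t ht)).trans ?_
      rw [setIntegral_condExp hle (hint _) ht, ← hchange _ (hint _) t (hle t ht)]
      refine setIntegral_congr_ae (hθ.measurable (hle t ht)) ?_
      filter_upwards [hf.equivariant γ x] with ω hω _ using hω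
    · refine StronglyMeasurable.aestronglyMeasurable ?_
      refine (stronglyMeasurable_condExp (m := ballSigma G (γ x) r)).comp_measurable ?_
      rw [← comap_actLabels_ballSigma γ x r]
      exact comap_measurable _

lemma integral_localField_mul_eq_zero (hG : G.Connected) {f : V → Labels V → ℝ}
    (hf0 : ∀ x, ∫ ω, f x ω ∂iidLaw V = 0) {x y : V} {r : ℕ} (h : 2 * r < G.dist x y) :
    ∫ ω, localField G r f x ω * localField G r f y ω ∂iidLaw V = 0 := by
  have hind : ProbabilityTheory.IndepFun (localField G r f x) (localField G r f y) (iidLaw V) := by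
    rw [ProbabilityTheory.IndepFun_iff_Indep]
    exact ProbabilityTheory.indep_of_indep_of_le (indep_ballSigma hG h)
      stronglyMeasurable_condExp.measurable.comap_le
      stronglyMeasurable_condExp.measurable.comap_le
  have := hind.integral_mul_eq_mul_integral integrable_condExp.aestronglyMeasurable
    integrable_condExp.aestronglyMeasurable
  refine this.trans ?_
  have h2 : ∫ ω, localField G r f x ω ∂iidLaw V = 0 := by
    unfold localField
    rw [integral_condExp (ballSigma_le x r), hf0]
  rw [h2, zero_mul]

/-- Lévy's upward theorem: the balls around `x` exhaust the vertices. -/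
lemma ae_tendsto_localField {f : V → Labels V → ℝ} (hf : ∀ x, Measurable (f x))
    (hint : ∀ x, Integrable (f x) (iidLaw V)) (x : V) :
    ∀ᵐ ω ∂iidLaw V, Filter.Tendsto (fun r => localField G r f x ω) Filter.atTop
      (nhds (f x ω)) := by
  let ℱ : Filtration ℕ (MeasurableSpace.pi : MeasurableSpace (Labels V)) :=
    ⟨ballSigma G x, ballSigma_mono x, ballSigma_le x⟩
  refine (hint x).tendsto_ae_condExp (ℱ := ℱ) ?_
  have : ⨆ n, ℱ n = MeasurableSpace.pi := iSup_ballSigma (G := G) x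
  rw [this]
  exact (hf x).stronglyMeasurable

variable [G.LocallyFinite] {d : ℕ}

lemma abs_nbrAvg_le {c : V → ℝ} {C : ℝ} (hC : 0 ≤ C) {x : V} (h : ∀ y ∈ G.neighborFinset x, |c y| ≤ C) :
    |nbrAvg G c x| ≤ C := by
  unfold nbrAvg
  rw [abs_div, Nat.abs_cast]
  refine div_le_of_le_mul₀ (by positivity) hC ?_
  refine (Finset.abs_sum_le_sum_abs _ _).trans ((Finset.sum_le_card_nsmul _ _ C h).trans ?_)
  rw [SimpleGraph.card_neighborFinset_eq_degree, nsmul_eq_mul, mul_comm]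

/-- The neighbour average contracts centred factors of IID on a regular tree. -/
lemma integral_avgField_sq_le_of_centred (hG : G.IsTree) (hd : 3 ≤ d)
    (hreg : G.IsRegularOfDegree d) (o : V) {f : V → Labels V → ℝ} (hf : IsField G f)
    (hfm : ∀ x, Measurable (f x)) (hf0 : ∀ x, ∫ ω, f x ω ∂iidLaw V = 0)
    (hf1 : ∀ x ω, |f x ω| ≤ 1) :
    ∫ ω, avgField G f o ω * avgField G f o ω ∂iidLaw V ≤
      (17 / 18) ^ 2 * ∫ ω, f o ω * f o ω ∂iidLaw V := by
  have hint : ∀ x, Integrable (f x) (iidLaw V) := fun x => (hf.memLp x).integrable (by norm_num)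
  have hlim := ae_tendsto_localField (G := G) hfm hint
  have hbd : ∀ r x, ∀ᵐ ω ∂iidLaw V, |localField G r f x ω| ≤ 1 := fun r x =>
    ae_bdd_abs_condExp_of_ae_bdd_abs (R := 1) (Filter.Eventually.of_forall fun ω => hf1 x ω)
  have hmul : ∀ a : ℝ, |a| ≤ 1 → ‖a * a‖ ≤ 1 := fun a ha => by
    rw [Real.norm_eq_abs, abs_mul]; exact mul_le_one₀ ha (abs_nonneg _) ha
  have hL : ∀ r, IsField G (localField G r f) := fun r => hf.localField r
  have h0 : Filter.Tendsto (fun r => ∫ ω, localField G r f o ω * localField G r f o ω ∂iidLaw V)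
      Filter.atTop (nhds (∫ ω, f o ω * f o ω ∂iidLaw V)) := by
    refine tendsto_integral_of_dominated_convergence (fun _ => 1)
      (fun r => ((hL r).integrable_mul (hL r) o o).aestronglyMeasurable)
      (integrable_const _) (fun r => ?_) ?_
    · filter_upwards [hbd r o] with ω hω using hmul _ hω
    · filter_upwards [hlim o] with ω hω using hω.mul hω
  have h1 : Filter.Tendsto (fun r => ∫ ω, avgField G (localField G r f) o ω *
      avgField G (localField G r f) o ω ∂iidLaw V)
      Filter.atTop (nhds (∫ ω, avgField G f o ω * avgField G f o ω ∂iidLaw V)) := by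
    refine tendsto_integral_of_dominated_convergence (fun _ => 1)
      (fun r => ((hL r).avg.integrable_mul (hL r).avg o o).aestronglyMeasurable)
      (integrable_const _) (fun r => ?_) ?_
    · have : ∀ᵐ ω ∂iidLaw V, ∀ y ∈ G.neighborFinset o, |localField G r f y ω| ≤ 1 :=
        (Finset.eventually_all _).2 fun y _ => hbd r y
      filter_upwards [this] with ω hω using hmul _ (abs_nbrAvg_le zero_le_one hω)
    · have : ∀ᵐ ω ∂iidLaw V, ∀ y ∈ G.neighborFinset o, Filter.Tendsto
          (fun r => localField G r f y ω) Filter.atTop (nhds (f y ω)) :=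
        (Finset.eventually_all _).2 fun y _ => hlim y
      filter_upwards [this] with ω hω
      have h2 : Filter.Tendsto (fun r => avgField G (localField G r f) o ω) Filter.atTop
          (nhds (avgField G f o ω)) := (tendsto_finsetSum _ hω).div_const _
      exact h2.mul h2
  -- The bound for finite-range fields is uniform in the range, so it passes to the limit. Fields
  -- seen through balls of radius `r` are independent at distances above `2 * r`.
  refine le_of_tendsto_of_tendsto' h1 (h0.const_mul _) fun r => ?_
  refine (hL r).integral_avgField_sq_le hG hd hreg o (2 * r) fun x hx => ?_
  rw [SimpleGraph.dist_comm] at hx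
  exact integral_localField_mul_eq_zero hG.connected hf0 hx

end SpectralGap

/-! ### Expansion of equivariant random sets -/

section Expansion

variable {V : Type*} {G : SimpleGraph V}

/-- An equivariant measurable random set of vertices; `A x` is the event that `x` is in it. -/
structure IsRandomSet (G : SimpleGraph V) (A : V → Set (Labels V)) : Prop where
  measurableSet : ∀ x, MeasurableSet (A x)
  equivariant : ∀ (γ : G ≃g G) x ω, actLabels γ ω ∈ A (γ x) ↔ ω ∈ A x

lemma IsRandomSet.compl {A : V → Set (Labels V)} (hA : IsRandomSet G A) :
    IsRandomSet G (fun x => (A x)ᶜ) where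
  measurableSet x := (hA.measurableSet x).compl
  equivariant γ x ω := not_congr (hA.equivariant γ x ω)

/-- The set of neighbours of a random set. -/
def nbrSet (G : SimpleGraph V) (A : V → Set (Labels V)) (x : V) : Set (Labels V) :=
  ⋃ y ∈ G.neighborSet x, A y

lemma mem_nbrSet {A : V → Set (Labels V)} {x : V} {ω : Labels V} :
    ω ∈ nbrSet G A x ↔ ∃ y, G.Adj x y ∧ ω ∈ A y := by
  simp [nbrSet]

lemma IsRandomSet.nbrSet [Countable V] {A : V → Set (Labels V)} (hA : IsRandomSet G A) :
    IsRandomSet G (nbrSet G A) where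
  measurableSet x := MeasurableSet.biUnion (Set.to_countable _) fun y _ => hA.measurableSet y
  equivariant γ x ω := by
    rw [mem_nbrSet, mem_nbrSet]
    constructor
    · rintro ⟨y, h1, h2⟩
      obtain ⟨y, rfl⟩ := γ.surjective y
      exact ⟨y, γ.map_adj_iff.1 h1, (hA.equivariant _ _ _).1 h2⟩
    · rintro ⟨y, h1, h2⟩
      exact ⟨γ y, γ.map_adj_iff.2 h1, (hA.equivariant _ _ _).2 h2⟩

lemma measure_eq_of_equivariant {A B : Set (Labels V)} (γ : G ≃g G) (hA : MeasurableSet A)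
    (h : ∀ ω, actLabels γ ω ∈ A ↔ ω ∈ B) : iidLaw V A = iidLaw V B := by
  rw [← (measurePreserving_actLabels γ).measure_preimage hA.nullMeasurableSet]
  congr 1
  ext ω
  exact h ω

lemma IsRandomSet.measure_eq {A : V → Set (Labels V)} (hA : IsRandomSet G A) (γ : G ≃g G) (x : V) :
    iidLaw V (A (γ x)) = iidLaw V (A x) :=
  measure_eq_of_equivariant γ (hA.measurableSet _) (hA.equivariant γ x)

lemma IsRandomSet.measure_eq_root [G.LocallyFinite] {d : ℕ} (hG : G.IsTree) (hd : 0 < d) (hreg : G.IsRegularOfDegree d)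
    {A : V → Set (Labels V)} (hA : IsRandomSet G A) (o x : V) :
    iidLaw V (A x) = iidLaw V (A o) := by
  obtain ⟨γ, rfl⟩ := exists_iso_apply_eq hG hd hreg o x
  exact hA.measure_eq γ o

/-- The centred indicator of a random set. -/
noncomputable def centredIndicator (A : V → Set (Labels V)) (a : ℝ) : V → Labels V → ℝ :=
  fun x ω => (A x).indicator 1 ω - a

lemma IsRandomSet.isField_centredIndicator {A : V → Set (Labels V)} (hA : IsRandomSet G A) (a : ℝ) :
    IsField G (centredIndicator A a) where
  memLp x := by
    refine MemLp.sub ?_ (memLp_const a)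
    exact (memLp_const (1 : ℝ)).indicator (hA.measurableSet x)
  equivariant γ x := by
    refine Filter.Eventually.of_forall fun ω => ?_
    classical
    simp only [centredIndicator, Set.indicator_apply, hA.equivariant, Pi.one_apply]

lemma integral_centredIndicator_mul {A B : V → Set (Labels V)} (hA : IsRandomSet G A)
    (hB : IsRandomSet G B) (x y : V) (a b : ℝ) :
    ∫ ω, centredIndicator A a x ω * centredIndicator B b y ω ∂iidLaw V =
      (iidLaw V).real (A x ∩ B y) - a * (iidLaw V).real (B y) - b * (iidLaw V).real (A x)
        + a * b := by
  have h : ∀ ω, centredIndicator A a x ω * centredIndicator B b y ω =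
      ((A x ∩ B y).indicator 1 ω - a * (B y).indicator 1 ω) -
        b * (A x).indicator 1 ω + a * b := by
    intro ω
    classical
    simp only [centredIndicator, Set.indicator_apply, Set.mem_inter_iff, Pi.one_apply]
    by_cases h1 : ω ∈ A x <;> by_cases h2 : ω ∈ B y <;> simp [h1, h2] <;> ring
  have hi : ∀ S : Set (Labels V), MeasurableSet S →
      Integrable (S.indicator (1 : Labels V → ℝ)) (iidLaw V) := fun S hS =>
    (integrable_const (1 : ℝ)).indicator hS
  have mA := hA.measurableSet x
  have mB := hB.measurableSet y
  have i1 := hi _ (mA.inter mB)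
  have i2 := (hi _ mB).const_mul a
  have i3 := (hi _ mA).const_mul b
  have i4 : Integrable (fun ω => (A x ∩ B y).indicator (1 : Labels V → ℝ) ω -
    a * (B y).indicator 1 ω) (iidLaw V) := i1.sub i2
  have i5 : Integrable (fun ω => (A x ∩ B y).indicator (1 : Labels V → ℝ) ω -
    a * (B y).indicator 1 ω - b * (A x).indicator 1 ω) (iidLaw V) := i4.sub i3
  simp only [h]
  rw [integral_add i5 (integrable_const _), integral_sub i4 i3, integral_sub i1 i2,
    integral_const_mul, integral_const_mul, integral_indicator_one (mA.inter mB),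
    integral_indicator_one mA, integral_indicator_one mB]
  simp

variable [G.LocallyFinite] {d : ℕ}

/-- Two random sets without edges between them. -/
lemma measure_mul_le_of_forall_not_adj (hG : G.IsTree) (hd : 3 ≤ d)
    (hreg : G.IsRegularOfDegree d) (o : V) {A B : V → Set (Labels V)} (hA : IsRandomSet G A)
    (hB : IsRandomSet G B) (hAB : ∀ x y, G.Adj x y → A x ∩ B y = ∅) :
    (iidLaw V).real (A o) * (iidLaw V).real (B o) ≤
      (17 / 18) ^ 2 * ((1 - (iidLaw V).real (A o)) * (1 - (iidLaw V).real (B o))) := by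
  have hd0 : 0 < d := by omega
  set a := (iidLaw V).real (A o)
  set b := (iidLaw V).real (B o)
  have ha : ∀ x, (iidLaw V).real (A x) = a := fun x => by
    simp only [a, measureReal_def, hA.measure_eq_root hG hd0 hreg o x]
  have hb : ∀ x, (iidLaw V).real (B x) = b := fun x => by
    simp only [b, measureReal_def, hB.measure_eq_root hG hd0 hreg o x]
  have ha0 : 0 ≤ a := measureReal_nonneg
  have hb0 : 0 ≤ b := measureReal_nonneg
  have ha1 : a ≤ 1 := measureReal_le_one
  have hb1 : b ≤ 1 := measureReal_le_one
  have hf := hA.isField_centredIndicator a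
  have hg := hB.isField_centredIndicator b
  -- Without edges between the sets, each neighbour contributes 0 - ab - ab + ab. Cauchy–Schwarz and
  -- the spectral gap then give (ab)² ≤ (17/18)² a(1-a) b(1-b), from which ab is cancelled.
  have h1 : ∫ ω, avgField G (centredIndicator A a) o ω * centredIndicator B b o ω ∂iidLaw V =
      -(a * b) := by
    rw [hf.integral_avgField_mul (hg.memLp o)]
    unfold nbrAvg
    have : ∀ y ∈ G.neighborFinset o, ∫ ω, centredIndicator A a y ω * centredIndicator B b o ω
        ∂iidLaw V = -(a * b) := by
      intro y hy
      rw [SimpleGraph.mem_neighborFinset] at hy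
      rw [integral_centredIndicator_mul hA hB, hAB y o hy.symm, ha, hb]
      simp
      ring
    rw [Finset.sum_congr rfl this, Finset.sum_const, SimpleGraph.card_neighborFinset_eq_degree,
      hreg o, nsmul_eq_mul, mul_div_cancel_left₀ _ (by positivity)]
  have h2 := sq_integral_mul_le (hf.avg.memLp o) (hg.memLp o)
  have h3 := integral_avgField_sq_le_of_centred hG hd hreg o hf
    (fun x => (measurable_one.indicator (hA.measurableSet x)).sub_const _)
    (fun x => by
      unfold centredIndicator
      have hi : Integrable ((A x).indicator (1 : Labels V → ℝ)) (iidLaw V) :=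
        (integrable_const (1 : ℝ)).indicator (hA.measurableSet x)
      rw [integral_sub hi (integrable_const _), integral_indicator_one (hA.measurableSet x), ha]
      simp)
    (fun x ω => by
      classical
      simp only [centredIndicator, Set.indicator_apply, Pi.one_apply]
      split_ifs <;> rw [abs_le] <;> constructor <;> linarith)
  rw [h1] at h2
  rw [integral_centredIndicator_mul hA hA, Set.inter_self, ha] at h3
  rw [integral_centredIndicator_mul hB hB, Set.inter_self, hb] at h2
  have hab : 0 ≤ (1 - a) * (1 - b) := mul_nonneg (by linarith) (by linarith)
  rcases (mul_nonneg ha0 hb0).eq_or_lt with h0 | h0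
  · rw [← h0]; positivity
  · have h4 : 0 ≤ b * (1 - b) := mul_nonneg hb0 (by linarith)
    refine le_of_mul_le_mul_left ?_ h0
    calc a * b * (a * b) = (-(a * b)) ^ 2 := by ring
      _ ≤ _ := h2
      _ = _ * (b * (1 - b)) := by ring
      _ ≤ ((17 / 18) ^ 2 * (a - a * a - a * a + a * a)) * (b * (1 - b)) := by gcongr
      _ = _ := by ring

/-- Expansion of factors of IID on a regular tree. -/
lemma measure_nbrSet_expansion (hG : G.IsTree) (hd : 3 ≤ d)
    (hreg : G.IsRegularOfDegree d) (o : V) {A : V → Set (Labels V)} (hA : IsRandomSet G A) :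
    (iidLaw V).real (A o) * (1 - (iidLaw V).real (nbrSet G A o)) ≤
      (17 / 18) ^ 2 * ((1 - (iidLaw V).real (A o)) * (iidLaw V).real (nbrSet G A o)) := by
  have := countable_vertices hG.connected
  have h := measure_mul_le_of_forall_not_adj hG hd hreg o hA hA.nbrSet.compl (fun x y hxy => by
    ext ω
    simp only [Set.mem_inter_iff, Set.mem_compl_iff, Set.mem_empty_iff_false, iff_false, not_and,
      not_not]
    exact fun h => mem_nbrSet.2 ⟨x, hxy.symm, h⟩)
  rw [probReal_compl_eq_one_sub (hA.nbrSet.measurableSet o), sub_sub_cancel] at h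
  exact h

end Expansion

/-! ### Alternating walks and augmenting paths -/

section AugmentingWalks

variable {V : Type*} {G : SimpleGraph V}

/-- The data of an augmenting path: a finite set that is closed under the matching `f`, contains a
vertex which `f` leaves free, and is perfectly matched by the edges `s (i, false)`, `s (i, true)`. -/
structure IsAugmenting (G : SimpleGraph V) (f : V → V) {n : ℕ} (s : Fin (n + 1) × Bool → V) :
    Prop where
  inj : Function.Injective s
  adj : ∀ i, G.Adj (s (i, false)) (s (i, true))
  closed : ∀ j, ∃ j', f (s j) = s j'
  free : f (s (0, false)) = s (0, false)

/-- An alternating walk of length `2 * k + 1` between free vertices of `f`. -/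
structure IsAugmentingWalk (G : SimpleGraph V) (f : V → V) (k : ℕ) (x : ℕ → V) : Prop where
  free_start : f (x 0) = x 0
  adj : ∀ i ≤ k, G.Adj (x (2 * i)) (x (2 * i + 1))
  matched : ∀ i < k, f (x (2 * i + 1)) = x (2 * i + 2)
  free_end : f (x (2 * k + 1)) = x (2 * k + 1)

/-- The vertices at the end of an alternating walk of length `2 * k` from a free vertex. -/
def reachable (G : SimpleGraph V) (f : V → V) : ℕ → Set V
  | 0 => {v | f v = v}
  | k + 1 => {v | ∃ w, G.Adj (f v) w ∧ w ∈ reachable G f k}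

lemma exists_walk_of_mem_reachable {f : V → V} (hf : ∀ v, f (f v) = v) {k : ℕ} {v : V}
    (h : v ∈ reachable G f k) : ∃ x : ℕ → V, f (x 0) = x 0 ∧
      (∀ i < k, G.Adj (x (2 * i)) (x (2 * i + 1)) ∧ f (x (2 * i + 1)) = x (2 * i + 2)) ∧
      x (2 * k) = v := by
  induction k generalizing v with
  | zero => exact ⟨fun _ => v, h, by simp, rfl⟩
  | succ k ih =>
    obtain ⟨w, hw, hr⟩ := h
    obtain ⟨x, h0, h1, h2⟩ := ih hr
    refine ⟨fun t => if t ≤ 2 * k then x t else if t = 2 * k + 1 then f v else v, by simpa using h0,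
      fun i hi => ?_, ?_⟩
    · rcases Nat.lt_succ_iff_lt_or_eq.1 hi with hi' | rfl
      · have e1 : 2 * i ≤ 2 * k := by omega
        have e2 : 2 * i + 1 ≤ 2 * k := by omega
        have e3 : 2 * i + 2 ≤ 2 * k := by omega
        simpa [e1, e2, e3] using h1 i hi'
      · simpa [h2, hf] using hw.symm
    · have e1 : ¬ 2 * (k + 1) ≤ 2 * k := by omega
      have e2 : 2 * (k + 1) ≠ 2 * k + 1 := by omega
      simp [e2]

lemma exists_augmentingWalk {f : V → V} (hf : ∀ v, f (f v) = v) {k : ℕ} {u w : V} (hu : f u = u)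
    (huw : G.Adj u w) (h : w ∈ reachable G f k) : ∃ x, IsAugmentingWalk G f k x := by
  obtain ⟨x, h0, h1, h2⟩ := exists_walk_of_mem_reachable hf h
  refine ⟨fun t => if t ≤ 2 * k then x t else u, by simpa using h0, fun i hi => ?_, fun i hi => ?_,
    ?_⟩
  · rcases hi.lt_or_eq with hi' | rfl
    · have e1 : 2 * i ≤ 2 * k := by omega
      have e2 : 2 * i + 1 ≤ 2 * k := by omega
      simpa [e1, e2] using (h1 i hi').1
    · simpa [h2] using huw.symm
  · have e2 : 2 * i + 1 ≤ 2 * k := by omega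
    have e3 : 2 * i + 2 ≤ 2 * k := by omega
    simpa [e2, e3] using (h1 i hi).2
  · simpa using hu

/-- Backtracking between odd positions can be cut out, giving a shorter augmenting walk.
Backtracking between even positions either contradicts that the start is free or, since `f` is an
involution, forces a backtrack between the preceding odd positions. -/
lemma IsAugmentingWalk.nonbacktracking {f : V → V} (hf : ∀ v, f (f v) = v) {k : ℕ} {x : ℕ → V}
    (hx : IsAugmentingWalk G f k x) (hmin : ∀ l < k, ∀ y, ¬ IsAugmentingWalk G f l y) :
    ∀ t, t + 1 < 2 * k + 1 → x t ≠ x (t + 2) := by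
  have hodd : ∀ j < k, x (2 * j + 1) ≠ x (2 * j + 3) := by
    intro j hj heq
    refine hmin (k - 1) (by omega) (fun t => if t < 2 * j + 2 then x t else x (t + 2)) ⟨?_, ?_, ?_, ?_⟩
    · simpa using hx.free_start
    · intro i hi
      by_cases h : i ≤ j
      · have e1 : 2 * i < 2 * j + 2 := by omega
        have e2 : 2 * i + 1 < 2 * j + 2 := by omega
        simpa [e1, e2] using hx.adj i (by omega)
      · have e1 : ¬ 2 * i < 2 * j + 2 := by omega
        have e2 : ¬ 2 * i + 1 < 2 * j + 2 := by omega
        simpa [e1, e2, mul_add] using hx.adj (i + 1) (by omega)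
    · intro i hi
      rcases lt_trichotomy i j with h | rfl | h
      · have e1 : 2 * i + 2 < 2 * j + 2 := by omega
        have e2 : 2 * i + 1 < 2 * j + 2 := by omega
        simpa [e1, e2] using hx.matched i (by omega)
      · have := hx.matched (i + 1) (by omega)
        simp only [Nat.lt_irrefl, if_false, add_lt_add_iff_left,
          Nat.one_lt_ofNat, if_true]
        rw [heq]
        exact this
      · have e1 : ¬ 2 * i + 2 < 2 * j + 2 := by omega
        have e2 : ¬ 2 * i + 1 < 2 * j + 2 := by omega
        simpa [e1, e2, mul_add] using hx.matched (i + 1) (by omega)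
    · have hend := hx.free_end
      by_cases h : k - 1 = j
      · have e2 : 2 * (k - 1) + 1 < 2 * j + 2 := by omega
        have e3 : 2 * k + 1 = 2 * j + 3 := by omega
        rw [e3, ← heq] at hend
        simp only [e2, if_true]
        rw [h]
        exact hend
      · have e2 : ¬ 2 * (k - 1) + 1 < 2 * j + 2 := by omega
        have e3 : 2 * (k - 1) + 1 + 2 = 2 * k + 1 := by omega
        simp only [e2, if_false, e3]
        exact hend
  intro t ht
  rcases Nat.even_or_odd' t with ⟨i, rfl | rfl⟩
  · intro heq
    have h1 := hx.matched i (by omega)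
    rw [← heq] at h1
    have h2 : f (x (2 * i)) = x (2 * i + 1) := by rw [← h1, hf]
    rcases i with _ | j
    · have h3 := hx.adj 0 (by omega)
      simp only [mul_zero, zero_add] at h2 h3
      rw [hx.free_start] at h2
      exact h3.ne h2
    · have h3 := hx.matched j (by omega)
      have h4 : f (x (2 * j + 2)) = x (2 * j + 1) := by rw [← h3, hf]
      exact hodd j (by omega) (h4.symm.trans h2)
  · exact hodd i (by omega)

/-- A shortest augmenting walk does not backtrack, and in a tree such a walk has distinct vertices.
Bipartiteness and parity play no further role. -/
lemma exists_isAugmenting (hG : G.IsTree) {f : V → V} (hf : ∀ v, f (f v) = v)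
    (hadj : ∀ v, f v = v ∨ G.Adj v (f v)) {k : ℕ} {u w : V} (hu : f u = u)
    (huw : G.Adj u w) (h : w ∈ reachable G f k) :
    ∃ n ≤ k, ∃ s : Fin (n + 1) × Bool → V, IsAugmenting G f s := by
  classical
  have hex : ∃ l, ∃ x, IsAugmentingWalk G f l x := ⟨k, exists_augmentingWalk hf hu huw h⟩
  obtain ⟨x, hx⟩ := Nat.find_spec hex
  have hmin : ∀ l < Nat.find hex, ∀ y, ¬ IsAugmentingWalk G f l y :=
    fun l hl y hy => Nat.find_min hex hl ⟨y, hy⟩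
  have hle : Nat.find hex ≤ k := Nat.find_min' hex (exists_augmentingWalk hf hu huw h)
  generalize Nat.find hex = n at hx hmin hle
  have hstep : ∀ t < 2 * n + 1, G.Adj (x t) (x (t + 1)) := by
    intro t ht
    rcases Nat.even_or_odd' t with ⟨i, rfl | rfl⟩
    · exact hx.adj i (by omega)
    · have h1 := hx.matched i (by omega)
      have h2 := hadj (x (2 * i + 1))
      rw [h1] at h2
      -- A free vertex met at an odd position would already end a shorter augmenting walk.
      refine h2.resolve_left fun h3 => hmin i (by omega) x
        ⟨hx.free_start, fun l hl => hx.adj l (by omega), fun l hl => hx.matched l (by omega), ?_⟩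
      rw [h1, h3]
  have hinj := injOn_of_nonbacktracking hG x (2 * n + 1) hstep (hx.nonbacktracking hf hmin)
  -- The index (i, b) stands for position 2i + b, so the pairs of `s` are the unmatched edges of the
  -- walk, those that augmentation turns into matching edges.
  refine ⟨n, hle, fun j => x (2 * j.1 + (if j.2 then 1 else 0)), ?_, ?_, ?_, ?_⟩
  · rintro ⟨i, b⟩ ⟨i', b'⟩ heq
    have h1 := hinj (by simp only [Set.mem_Iic]; have := i.2; split_ifs <;> omega)
      (by simp only [Set.mem_Iic]; have := i'.2; split_ifs <;> omega) heq
    simp only at h1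
    cases b <;> cases b' <;> simp only [Bool.false_eq_true, if_false, if_true] at h1 <;>
      first
      | omega
      | (rw [Prod.mk.injEq]; exact ⟨Fin.ext (by omega), rfl⟩)
  · intro i
    simpa using hx.adj i (by have := i.2; omega)
  · rintro ⟨i, b⟩
    cases b
    · rcases hi : i.1 with _ | j
      · refine ⟨(i, false), ?_⟩
        simp only [Bool.false_eq_true, if_false, hi]
        exact hx.free_start
      · refine ⟨(⟨j, by omega⟩, true), ?_⟩
        simp only [Bool.false_eq_true, if_false, if_true]
        have := hx.matched j (by omega)
        rw [show 2 * (j + 1) + 0 = 2 * j + 2 by ring, ← this, hf]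
    · by_cases hi : i.1 = n
      · refine ⟨(i, true), ?_⟩
        simp only [if_true, hi]
        exact hx.free_end
      · refine ⟨(⟨i.1 + 1, by omega⟩, false), ?_⟩
        simp only [Bool.false_eq_true, if_false, if_true]
        exact hx.matched i.1 (by omega)
  · simpa using hx.free_start

end AugmentingWalks

/-! ### Equivariant matchings without short augmenting paths -/

section RandomMatching

variable {V : Type*} {G : SimpleGraph V}

/-- A measurable equivariant matching: `m ω v` is the partner of `v`, or `v` itself if `v` is
free. -/
structure IsRandomMatching (G : SimpleGraph V) (m : Labels V → V → V) : Prop where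
  measurableSet : ∀ x y, MeasurableSet {ω | m ω x = y}
  equivariant : ∀ (γ : G ≃g G) ω x, m (actLabels γ ω) (γ x) = γ (m ω x)
  invol : ∀ ω x, m ω (m ω x) = x
  adj : ∀ ω x, m ω x = x ∨ G.Adj x (m ω x)

/-- The random set of free vertices. -/
def freeSet (m : Labels V → V → V) (x : V) : Set (Labels V) := {ω | m ω x = x}

/-- The event that `x` is reached from the free vertices by an alternating walk of length
`2 * k`. -/
def reachSet (G : SimpleGraph V) (m : Labels V → V → V) (k : ℕ) (x : V) : Set (Labels V) :=
  {ω | x ∈ reachable G (m ω) k}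

/-- Mass transport for disjoint events. -/
lemma measure_iUnion_transport [G.LocallyFinite] {d : ℕ} (hG : G.IsTree) (hd : 0 < d)
    (hreg : G.IsRegularOfDegree d) (o : V) {Q : V → V → Set (Labels V)}
    (hQ : ∀ x y, MeasurableSet (Q x y))
    (hequiv : ∀ (γ : G ≃g G) x y ω, actLabels γ ω ∈ Q (γ x) (γ y) ↔ ω ∈ Q x y)
    (h1 : Pairwise fun u v => Disjoint (Q o u) (Q o v))
    (h2 : Pairwise fun u v => Disjoint (Q u o) (Q v o)) :
    iidLaw V (⋃ v, Q o v) = iidLaw V (⋃ v, Q v o) := by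
  have := countable_vertices hG.connected
  rw [measure_iUnion h1 fun v => hQ o v, measure_iUnion h2 fun v => hQ v o]
  exact tsum_transport hG hd hreg o (fun x y => iidLaw V (Q x y)) fun γ x y =>
    measure_eq_of_equivariant γ (hQ _ _) (hequiv γ x y)

namespace IsRandomMatching

variable {m : Labels V → V → V}

lemma freeSet (hm : IsRandomMatching G m) : IsRandomSet G (freeSet m) where
  measurableSet x := hm.measurableSet x x
  equivariant γ x ω := by
    simp only [TreeMatching.freeSet, Set.mem_ofPred_eq, hm.equivariant, γ.injective.eq_iff]

/-- The random set of partners of a random set. -/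
lemma partnerSet [Countable V] (hm : IsRandomMatching G m) {A : V → Set (Labels V)}
    (hA : IsRandomSet G A) : IsRandomSet G (fun x => {ω | ω ∈ A (m ω x)}) where
  measurableSet x := by
    have : {ω | ω ∈ A (m ω x)} = ⋃ y, {ω | m ω x = y} ∩ A y := by ext ω; simp
    rw [this]
    exact MeasurableSet.iUnion fun y => (hm.measurableSet x y).inter (hA.measurableSet y)
  equivariant γ x ω := by
    simp only [Set.mem_ofPred_eq, hm.equivariant, hA.equivariant]

/-- Every vertex sends mass one to its partner when that partner lies in the set; each vertex of the
set receives mass from exactly one vertex. -/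
lemma measure_partnerSet [G.LocallyFinite] {d : ℕ} (hG : G.IsTree) (hd : 0 < d)
    (hreg : G.IsRegularOfDegree d) (o : V) (hm : IsRandomMatching G m) {A : V → Set (Labels V)}
    (hA : IsRandomSet G A) : iidLaw V {ω | ω ∈ A (m ω o)} = iidLaw V (A o) := by
  have h := measure_iUnion_transport hG hd hreg o (Q := fun x y => {ω | m ω x = y} ∩ A y)
    (fun x y => (hm.measurableSet x y).inter (hA.measurableSet y))
    (fun γ x y ω => by
      simp only [Set.mem_inter_iff, Set.mem_ofPred_eq, hm.equivariant, γ.injective.eq_iff,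
        hA.equivariant])
    (fun u v huv => Set.disjoint_left.2 fun ω h1 h2 => huv (h1.1.symm.trans h2.1))
    (fun u v huv => Set.disjoint_left.2 fun ω h1 h2 => huv (by
      have e1 : m ω u = o := h1.1
      have e2 : m ω v = o := h2.1
      rw [← hm.invol ω u, ← hm.invol ω v, e1, e2]))
  have e1 : ⋃ v, {ω | m ω o = v} ∩ A v = {ω | ω ∈ A (m ω o)} := by ext ω; simp
  have e2 : ⋃ v, {ω | m ω v = o} ∩ A o = A o := by
    ext ω
    simp only [Set.mem_iUnion, Set.mem_inter_iff, Set.mem_ofPred_eq, exists_and_right,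
      and_iff_right_iff_imp]
    exact fun _ => ⟨m ω o, hm.invol ω o⟩
  rwa [e1, e2] at h

lemma reachSet [Countable V] (hm : IsRandomMatching G m) (k : ℕ) :
    IsRandomSet G (reachSet G m k) := by
  induction k with
  | zero => exact hm.freeSet
  | succ k ih =>
    have := hm.partnerSet ih.nbrSet
    convert this using 2 with x
    ext ω
    simp only [Set.mem_ofPred_eq, mem_nbrSet]
    rfl

lemma measure_reachSet_succ [G.LocallyFinite] {d : ℕ} (hG : G.IsTree) (hd : 0 < d)
    (hreg : G.IsRegularOfDegree d) (o : V) (hm : IsRandomMatching G m) (k : ℕ) :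
    iidLaw V (TreeMatching.reachSet G m (k + 1) o) =
      iidLaw V (nbrSet G (TreeMatching.reachSet G m k) o) := by
  have := countable_vertices hG.connected
  rw [← hm.measure_partnerSet hG hd hreg o (hm.reachSet k).nbrSet]
  congr 1
  ext ω
  simp only [Set.mem_ofPred_eq, mem_nbrSet]
  rfl

/-- Without short augmenting walks, free vertices are exponentially rare. -/
lemma measure_freeSet_le [G.LocallyFinite] {d : ℕ} (hG : G.IsTree) (hd : 3 ≤ d)
    (hreg : G.IsRegularOfDegree d) (o : V) (hm : IsRandomMatching G m) (K : ℕ)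
    (hK : ∀ k ≤ K, iidLaw V (nbrSet G (TreeMatching.reachSet G m k) o ∩
      TreeMatching.freeSet m o) = 0) :
    (iidLaw V).real (TreeMatching.freeSet m o) ≤ (17 / 18) ^ (K + 1) := by
  have := countable_vertices hG.connected
  set p := (iidLaw V).real (TreeMatching.freeSet m o)
  let a : ℕ → ℝ := fun k => (iidLaw V).real (TreeMatching.reachSet G m k o)
  have ha0 : a 0 = p := rfl
  have hasucc : ∀ k, a (k + 1) = (iidLaw V).real (nbrSet G (TreeMatching.reachSet G m k) o) :=
    fun k => by simp only [a, measureReal_def, hm.measure_reachSet_succ hG (by omega) hreg o]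
  have hexp : ∀ k, a k * (1 - a (k + 1)) ≤ (17 / 18) ^ 2 * ((1 - a k) * a (k + 1)) := fun k => by
    rw [hasucc]
    exact measure_nbrSet_expansion hG hd hreg o (hm.reachSet k)
  have hann : ∀ k, 0 ≤ a k := fun k => measureReal_nonneg
  have hale : ∀ k, a k ≤ 1 := fun k => measureReal_le_one
  -- A free vertex adjacent to a reached one would close an augmenting walk, so these two events are
  -- disjoint up to a null set.
  have hfin : a (K + 1) ≤ 1 - p := by
    have h1 : (iidLaw V).real (nbrSet G (TreeMatching.reachSet G m K) o ∪
        TreeMatching.freeSet m o) = a (K + 1) + p := by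
      have := measureReal_union_add_inter (μ := iidLaw V)
        (s := nbrSet G (TreeMatching.reachSet G m K) o) (hm.freeSet.measurableSet o)
      rw [hasucc, ← this, measureReal_def (iidLaw V) (_ ∩ _), hK K le_rfl]
      simp
    have h2 : (iidLaw V).real (nbrSet G (TreeMatching.reachSet G m K) o ∪
        TreeMatching.freeSet m o) ≤ 1 := measureReal_le_one
    linarith
  have hp0 : 0 ≤ p := measureReal_nonneg
  rcases hp0.eq_or_lt with hp | hp
  · rw [← hp]; positivity
  -- The odds a/(1-a) grow by a factor of at least (18/17)² per step, written without division since
  -- 1 - a may vanish.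
  have key : ∀ k, 0 < a k ∧ p * (1 - a k) ≤ ((17 / 18) ^ k) ^ 2 * ((1 - p) * a k) := by
    intro k
    induction k with
    | zero => rw [ha0]; exact ⟨hp, by simp [mul_comm]⟩
    | succ k ih =>
      obtain ⟨h1, h2⟩ := ih
      have h3 := hexp k
      have h4 : 0 < a (k + 1) := by
        refine (hann _).lt_of_ne fun h => ?_
        rw [← h] at h3
        simp at h3
        linarith
      refine ⟨h4, le_of_mul_le_mul_left ?_ h1⟩
      calc a k * (p * (1 - a (k + 1))) = p * (a k * (1 - a (k + 1))) := by ring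
        _ ≤ p * ((17 / 18) ^ 2 * ((1 - a k) * a (k + 1))) := by gcongr
        _ = (17 / 18) ^ 2 * a (k + 1) * (p * (1 - a k)) := by ring
        _ ≤ (17 / 18) ^ 2 * a (k + 1) * (((17 / 18) ^ k) ^ 2 * ((1 - p) * a k)) := by gcongr
        _ = _ := by ring
  have h1 := (key (K + 1)).2
  have hp1 : p ≤ 1 := measureReal_le_one
  refine le_of_sq_le_sq ?_ (by positivity)
  calc p ^ 2 ≤ p * (1 - a (K + 1)) := by rw [sq]; gcongr; linarith
    _ ≤ _ := h1
    _ ≤ ((17 / 18) ^ (K + 1)) ^ 2 * (1 * 1) := by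
      gcongr
      · linarith
      · exact hale _
    _ = _ := by ring

lemma exists_isAugmenting [G.LocallyFinite] {d : ℕ} (hG : G.IsTree) (hd : 3 ≤ d)
    (hreg : G.IsRegularOfDegree d) (o : V) (hm : IsRandomMatching G m) (K : ℕ)
    (hK : (17 / 18) ^ (K + 1) < (iidLaw V).real (TreeMatching.freeSet m o)) :
    ∃ n ≤ K, ∃ s : Fin (n + 1) × Bool → V, iidLaw V {ω | IsAugmenting G (m ω) s} ≠ 0 := by
  have := countable_vertices hG.connected
  by_contra! hno
  refine absurd (hm.measure_freeSet_le hG hd hreg o K fun k hk => ?_) (not_le.2 hK)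
  have hnull : iidLaw V (⋃ n : Fin (K + 1), ⋃ s : Fin (n.1 + 1) × Bool → V,
      {ω | IsAugmenting G (m ω) s}) = 0 :=
    measure_iUnion_null fun n => measure_iUnion_null fun s => hno n.1 (by omega) s
  refine measure_mono_null (fun ω hω => ?_) hnull
  obtain ⟨w, h1, h2⟩ := mem_nbrSet.1 hω.1
  obtain ⟨n, hn, s, hs⟩ := TreeMatching.exists_isAugmenting hG (hm.invol ω) (hm.adj ω) hω.2 h1 h2
  exact Set.mem_iUnion.2 ⟨⟨n, by omega⟩, Set.mem_iUnion.2 ⟨s, hs⟩⟩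

end IsRandomMatching

end RandomMatching

/-! ### Isolating vertices by their labels -/

section Isolation

variable {V : Type*}

lemma ae_labels_ne {x y : V} (h : x ≠ y) : ∀ᵐ ω ∂iidLaw V, ω x ≠ ω y := by
  have hatom : ∀ t : unitInterval, (volume : Measure unitInterval) {t} = 0 := fun t => by
    refine (comap_subtype_coe_apply measurableSet_Icc volume {t}).trans ?_
    rw [Set.image_singleton, Real.volume_singleton]
  have hdiag : MeasurableSet {q : unitInterval × unitInterval | q.1 = q.2} :=
    measurableSet_eq_fun measurable_fst measurable_snd
  have h1 := Measure.infinitePi_map_eval_prod (P := fun _ : V => (volume : Measure unitInterval)) h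
  have h2 : (volume : Measure unitInterval).prod volume {q | q.1 = q.2} = 0 := by
    rw [Measure.measure_prod_null hdiag]
    refine Filter.Eventually.of_forall fun t => ?_
    refine measure_mono_null (fun s hs => ?_) (hatom t)
    have : t = s := hs
    exact this.symm
  rw [← h1, Measure.map_apply ((measurable_pi_apply x).prodMk (measurable_pi_apply y)) hdiag] at h2
  rw [ae_iff]
  simp only [not_not]
  exact h2

lemma ae_labels_injective [Countable V] : ∀ᵐ ω ∂iidLaw V, Function.Injective ω := by
  have : ∀ᵐ ω ∂iidLaw V, ∀ x y : V, x ≠ y → ω x ≠ ω y :=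
    ae_all_iff.2 fun x => ae_all_iff.2 fun y => by
      by_cases h : x = y
      · simp [h]
      · filter_upwards [ae_labels_ne h] with ω hω _ using hω
  filter_upwards [this] with ω hω x y hxy
  by_contra h
  exact hω x y h hxy

/-- Sets from a countable basis leave only countably many choices, so that one fixed choice can
later be made to work with positive probability. -/
lemma exists_isolating_open {ω : Labels V} (hω : Function.Injective ω) {F : Set V} (hF : F.Finite)
    (x : V) : ∃ I : TopologicalSpace.countableBasis unitInterval, ω x ∈ I.1 ∧
      ∀ y ∈ F, ω y ∈ I.1 → y = x := by
  have hopen : IsOpen ((ω '' (F \ {x}))ᶜ) := ((hF.sdiff).image ω).isClosed.isOpen_compl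
  have hmem : ω x ∈ (ω '' (F \ {x}))ᶜ := by
    rintro ⟨y, hy, hxy⟩
    exact hy.2 (hω hxy)
  obtain ⟨I, hI, h1, h2⟩ :=
    (TopologicalSpace.isBasis_countableBasis unitInterval).exists_subset_of_mem_open hmem hopen
  refine ⟨⟨I, hI⟩, h1, fun y hy hyI => ?_⟩
  by_contra hne
  exact h2 hyI ⟨y, ⟨hy, hne⟩, rfl⟩

end Isolation

/-! ### Simultaneous augmentation along disjoint paths -/

section Augmentation

variable {V : Type*} {G : SimpleGraph V} {n : ℕ}

/-- Augmenting data of diameter at most `D` whose labels lie in the sets `I j`, while no other label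
nearby does. -/
structure IsSelected (G : SimpleGraph V) (m : Labels V → V → V)
    (I : Fin (n + 1) × Bool → TopologicalSpace.countableBasis unitInterval) (D : ℕ)
    (ω : Labels V) (s : Fin (n + 1) × Bool → V) : Prop where
  isAugmenting : IsAugmenting G (m ω) s
  dist_le : ∀ i j, G.dist (s i) (s j) ≤ D
  label_mem : ∀ j, ω (s j) ∈ (I j).1
  isolated : ∀ j y, G.dist (s j) y ≤ 2 * D → ω y ∈ (I j).1 → y = s j

variable {m : Labels V → V → V}
  {I : Fin (n + 1) × Bool → TopologicalSpace.countableBasis unitInterval} {D : ℕ}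

/-- If two selected families share a vertex, vertices of equal index are within `2 * D` of each
other and both have labels in `I j`; isolation makes them equal. This is where the radius `2 * D`
comes from. -/
lemma IsSelected.eq_of_apply_eq (hG : G.Connected) {ω : Labels V} {s s' : Fin (n + 1) × Bool → V}
    (hs : IsSelected G m I D ω s) (hs' : IsSelected G m I D ω s') {i i' : Fin (n + 1) × Bool}
    (h : s i = s' i') : s = s' := by
  funext j
  refine (hs.isolated j (s' j) ?_ (hs'.label_mem j)).symm
  have h1 := hG.dist_triangle (u := s j) (v := s i) (w := s' j)
  have h2 := hs.dist_le j i
  have h3 := hs'.dist_le i' j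
  rw [← h] at h3
  omega

lemma IsSelected.eq_and_eq_of_apply_eq (hG : G.Connected) {ω : Labels V}
    {s s' : Fin (n + 1) × Bool → V} (hs : IsSelected G m I D ω s) (hs' : IsSelected G m I D ω s')
    {i i' : Fin (n + 1) × Bool} (h : s i = s' i') : s = s' ∧ i = i' := by
  obtain rfl := hs.eq_of_apply_eq hG hs' h
  exact ⟨rfl, hs.isAugmenting.inj h⟩

lemma IsAugmenting.comp_iso {f g : V → V} (γ : G ≃g G) (h : ∀ x, g (γ x) = γ (f x))
    {s : Fin (n + 1) × Bool → V} (hs : IsAugmenting G f s) : IsAugmenting G g (γ ∘ s) where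
  inj := γ.injective.comp hs.inj
  adj i := γ.map_adj_iff.2 (hs.adj i)
  closed j := by
    obtain ⟨j', hj'⟩ := hs.closed j
    exact ⟨j', by simp [h, hj']⟩
  free := by simp [h, hs.free]

lemma IsSelected.comp_iso (hm : IsRandomMatching G m) (γ : G ≃g G) {ω : Labels V}
    {s : Fin (n + 1) × Bool → V} (hs : IsSelected G m I D ω s) :
    IsSelected G m I D (actLabels γ ω) (γ ∘ s) where
  isAugmenting := hs.isAugmenting.comp_iso γ (hm.equivariant γ ω)
  dist_le i j := by simpa [dist_iso] using hs.dist_le i j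
  label_mem j := by simpa [actLabels] using hs.label_mem j
  isolated j y h1 h2 := by
    obtain ⟨y, rfl⟩ := γ.surjective y
    simp only [Function.comp_apply, dist_iso] at h1
    rw [hs.isolated j y h1 (by simpa [actLabels] using h2), Function.comp_apply]

lemma isSelected_comp_iso_iff (hm : IsRandomMatching G m) (γ : G ≃g G) {ω : Labels V}
    {s : Fin (n + 1) × Bool → V} :
    IsSelected G m I D (actLabels γ ω) (γ ∘ s) ↔ IsSelected G m I D ω s := by
  refine ⟨fun h => ?_, fun h => h.comp_iso hm γ⟩
  have := h.comp_iso hm γ.symm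
  rw [actLabels_symm_actLabels] at this
  convert this using 1
  funext j
  simp

lemma measurableSet_isAugmenting (hm : IsRandomMatching G m) (s : Fin (n + 1) × Bool → V) :
    MeasurableSet {ω | IsAugmenting G (m ω) s} := by
  have : {ω | IsAugmenting G (m ω) s} = {_ω | Function.Injective s} ∩
      ({_ω | ∀ i, G.Adj (s (i, false)) (s (i, true))} ∩
        ((⋂ j, ⋃ j', {ω | m ω (s j) = s j'}) ∩ {ω | m ω (s (0, false)) = s (0, false)})) := by
    ext ω
    simp only [Set.mem_ofPred_eq, Set.mem_inter_iff, Set.mem_iInter, Set.mem_iUnion]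
    exact ⟨fun h => ⟨h.inj, h.adj, h.closed, h.free⟩, fun h => ⟨h.1, h.2.1, h.2.2.1, h.2.2.2⟩⟩
  rw [this]
  exact (MeasurableSet.const _).inter ((MeasurableSet.const _).inter
    ((MeasurableSet.iInter fun j => MeasurableSet.iUnion fun j' => hm.measurableSet _ _).inter
      (hm.measurableSet _ _)))

lemma measurableSet_isSelected [Countable V] (hm : IsRandomMatching G m)
    (s : Fin (n + 1) × Bool → V) : MeasurableSet {ω | IsSelected G m I D ω s} := by
  have hI : ∀ j x, MeasurableSet {ω : Labels V | ω x ∈ (I j).1} := fun j x =>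
    measurable_pi_apply x (TopologicalSpace.isOpen_of_mem_countableBasis (I j).2).measurableSet
  have : {ω | IsSelected G m I D ω s} = {ω | IsAugmenting G (m ω) s} ∩
      ({_ω | ∀ i j, G.dist (s i) (s j) ≤ D} ∩ ((⋂ j, {ω | ω (s j) ∈ (I j).1}) ∩
        ⋂ j, ⋂ y, ({_ω | G.dist (s j) y ≤ 2 * D}ᶜ ∪ ({ω | ω y ∈ (I j).1}ᶜ ∪ {_ω | y = s j})))) := by
    ext ω
    simp only [Set.mem_ofPred_eq, Set.mem_inter_iff, Set.mem_iInter, Set.mem_union,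
      Set.mem_compl_iff, ← imp_iff_not_or]
    exact ⟨fun h => ⟨h.1, h.2, h.3, h.4⟩, fun h => ⟨h.1, h.2.1, h.2.2.1, h.2.2.2⟩⟩
  rw [this]
  exact (measurableSet_isAugmenting hm s).inter ((MeasurableSet.const _).inter
    ((MeasurableSet.iInter fun j => hI _ _).inter (MeasurableSet.iInter fun j =>
      MeasurableSet.iInter fun y => (MeasurableSet.const _).compl.union
        ((hI _ _).compl.union (MeasurableSet.const _)))))

/-- The event that `x` is the vertex with index `j` of some selected augmenting data. -/
def selectedSet (G : SimpleGraph V) (m : Labels V → V → V)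
    (I : Fin (n + 1) × Bool → TopologicalSpace.countableBasis unitInterval) (D : ℕ)
    (j : Fin (n + 1) × Bool) (x : V) : Set (Labels V) :=
  {ω | ∃ s, IsSelected G m I D ω s ∧ s j = x}

lemma exists_isSelected_comp_iso_iff (hm : IsRandomMatching G m) (γ : G ≃g G) {ω : Labels V}
    {i j : Fin (n + 1) × Bool} {x y : V} :
    (∃ s, IsSelected G m I D (actLabels γ ω) s ∧ s i = γ x ∧ s j = γ y) ↔
      ∃ s, IsSelected G m I D ω s ∧ s i = x ∧ s j = y := by
  constructor
  · rintro ⟨s, hs, h1, h2⟩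
    have hsγ : γ ∘ (γ.symm ∘ s) = s := by funext j; simp
    refine ⟨γ.symm ∘ s, ?_, by simp [h1], by simp [h2]⟩
    rwa [← isSelected_comp_iso_iff hm γ, hsγ]
  · rintro ⟨s, hs, rfl, rfl⟩
    exact ⟨γ ∘ s, hs.comp_iso hm γ, rfl, rfl⟩

lemma measurableSet_exists_isSelected [Countable V] (hm : IsRandomMatching G m)
    (P : (Fin (n + 1) × Bool → V) → Prop) :
    MeasurableSet {ω | ∃ s, IsSelected G m I D ω s ∧ P s} := by
  have : {ω | ∃ s, IsSelected G m I D ω s ∧ P s} =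
      ⋃ s, ({ω | IsSelected G m I D ω s} ∩ {_ω | P s}) := by
    ext ω; simp
  rw [this]
  exact MeasurableSet.iUnion fun s => (measurableSet_isSelected hm s).inter (MeasurableSet.const _)

lemma isRandomSet_selectedSet [Countable V] (hm : IsRandomMatching G m)
    (j : Fin (n + 1) × Bool) : IsRandomSet G (selectedSet G m I D j) where
  measurableSet x := measurableSet_exists_isSelected hm _
  equivariant γ x ω := by
    have h := exists_isSelected_comp_iso_iff (I := I) (D := D) hm γ (ω := ω) (i := j) (j := j)
      (x := x) (y := x)
    simp only [and_self] at h
    exact h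

/-- Selected families are disjoint, so sending mass from the vertex of index `i` to that of index
`j` is a well-defined transport. -/
lemma measure_selectedSet_eq [G.LocallyFinite] {d : ℕ} (hG : G.IsTree) (hd : 0 < d)
    (hreg : G.IsRegularOfDegree d) (o : V) (hm : IsRandomMatching G m)
    (i j : Fin (n + 1) × Bool) :
    iidLaw V (selectedSet G m I D i o) = iidLaw V (selectedSet G m I D j o) := by
  have := countable_vertices hG.connected
  have h := measure_iUnion_transport hG hd hreg o
    (Q := fun x y => {ω | ∃ s, IsSelected G m I D ω s ∧ s i = x ∧ s j = y})
    (fun x y => measurableSet_exists_isSelected hm _)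
    (fun γ x y ω => exists_isSelected_comp_iso_iff hm γ)
    (fun u v huv => Set.disjoint_left.2 fun ω => by
      rintro ⟨s, hs, h1, h2⟩ ⟨s', hs', h1', h2'⟩
      obtain rfl := hs.eq_of_apply_eq hG.connected hs' (h1.trans h1'.symm)
      exact huv (h2.symm.trans h2'))
    (fun u v huv => Set.disjoint_left.2 fun ω => by
      rintro ⟨s, hs, h1, h2⟩ ⟨s', hs', h1', h2'⟩
      obtain rfl := hs.eq_of_apply_eq hG.connected hs' (h2.trans h2'.symm)
      exact huv (h1.symm.trans h1'))
  convert h using 2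
  · ext ω; simp [selectedSet]
  · ext ω; simp [selectedSet]

open Classical in
/-- The matching `m` augmented along all selected data. -/
noncomputable def augment (G : SimpleGraph V) (m : Labels V → V → V)
    (I : Fin (n + 1) × Bool → TopologicalSpace.countableBasis unitInterval) (D : ℕ) :
    Labels V → V → V := fun ω x =>
  if h : ∃ p : (Fin (n + 1) × Bool → V) × (Fin (n + 1) × Bool),
    IsSelected G m I D ω p.1 ∧ p.1 p.2 = x then h.choose.1 (h.choose.2.1, !h.choose.2.2) else m ω x

lemma augment_apply_of_isSelected (hG : G.Connected) {ω : Labels V} {s : Fin (n + 1) × Bool → V}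
    (hs : IsSelected G m I D ω s) (j : Fin (n + 1) × Bool) :
    augment G m I D ω (s j) = s (j.1, !j.2) := by
  have h : ∃ p : (Fin (n + 1) × Bool → V) × (Fin (n + 1) × Bool),
    IsSelected G m I D ω p.1 ∧ p.1 p.2 = s j := ⟨(s, j), hs, rfl⟩
  unfold augment
  rw [dif_pos h]
  obtain ⟨h1, h2⟩ := h.choose_spec.1.eq_and_eq_of_apply_eq hG hs h.choose_spec.2
  rw [h1, h2]

lemma augment_apply_of_not {ω : Labels V} {x : V}
    (h : ∀ s j, IsSelected G m I D ω s → s j ≠ x) : augment G m I D ω x = m ω x := by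
  unfold augment
  rw [dif_neg]
  rintro ⟨p, h1, h2⟩
  exact h _ _ h1 h2

/-- Selected families are pairwise disjoint, so all can be flipped at once. They are closed under
`m`, so an untouched vertex never loses its partner. -/
lemma IsRandomMatching.augment [Countable V] (hG : G.Connected) (hm : IsRandomMatching G m) :
    IsRandomMatching G (augment G m I D) where
  measurableSet x y := by
    have : {ω | TreeMatching.augment G m I D ω x = y} =
        (⋃ j : Fin (n + 1) × Bool, {ω | ∃ s, IsSelected G m I D ω s ∧ s j = x ∧ s (j.1, !j.2) = y}) ∪
        ((⋃ j : Fin (n + 1) × Bool, selectedSet G m I D j x)ᶜ ∩ {ω | m ω x = y}) := by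
      ext ω
      simp only [Set.mem_ofPred_eq, Set.mem_union, Set.mem_iUnion, Set.mem_inter_iff,
        Set.mem_compl_iff, selectedSet]
      by_cases h : ∃ j s, IsSelected G m I D ω s ∧ s j = x
      · have h' := h
        obtain ⟨j, s, hs, rfl⟩ := h'
        simp only [h, not_true, false_and, or_false]
        rw [augment_apply_of_isSelected hG hs]
        constructor
        · exact fun h => ⟨j, s, hs, rfl, h⟩
        · rintro ⟨j', s', hs', h1, h2⟩
          obtain ⟨rfl, rfl⟩ := hs'.eq_and_eq_of_apply_eq hG hs h1
          exact h2
      · rw [augment_apply_of_not fun s j hs hx => h ⟨j, s, hs, hx⟩]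
        simp only [h, not_false_eq_true, true_and]
        refine ⟨Or.inr, fun h' => h'.resolve_left ?_⟩
        rintro ⟨j, s, hs, h1, -⟩
        exact h ⟨j, s, hs, h1⟩
    rw [this]
    exact (MeasurableSet.iUnion fun j => measurableSet_exists_isSelected hm _).union
      ((MeasurableSet.iUnion fun j => (isRandomSet_selectedSet hm j).measurableSet x).compl.inter
        (hm.measurableSet x y))
  equivariant γ ω x := by
    by_cases h : ∃ j s, IsSelected G m I D ω s ∧ s j = x
    · obtain ⟨j, s, hs, rfl⟩ := h
      rw [augment_apply_of_isSelected hG hs]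
      exact augment_apply_of_isSelected hG (hs.comp_iso hm γ) j
    · rw [augment_apply_of_not fun s j hs hx => h ⟨j, s, hs, hx⟩, augment_apply_of_not,
        hm.equivariant]
      intro s j hs hx
      obtain ⟨s, hs, h1, -⟩ := (exists_isSelected_comp_iso_iff hm γ).1 ⟨s, hs, hx, hx⟩
      exact h ⟨j, s, hs, h1⟩
  invol ω x := by
    by_cases h : ∃ j s, IsSelected G m I D ω s ∧ s j = x
    · obtain ⟨j, s, hs, rfl⟩ := h
      rw [augment_apply_of_isSelected hG hs, augment_apply_of_isSelected hG hs]
      simp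
    · rw [augment_apply_of_not fun s j hs hx => h ⟨j, s, hs, hx⟩, augment_apply_of_not, hm.invol]
      intro s j hs hx
      obtain ⟨j', hj'⟩ := hs.isAugmenting.closed j
      rw [hx, hm.invol] at hj'
      exact h ⟨j', s, hs, hj'.symm⟩
  adj ω x := by
    by_cases h : ∃ j s, IsSelected G m I D ω s ∧ s j = x
    · obtain ⟨⟨i, b⟩, s, hs, rfl⟩ := h
      rw [augment_apply_of_isSelected hG hs]
      right
      cases b
      · exact hs.isAugmenting.adj i
      · exact (hs.isAugmenting.adj i).symm
    · rw [augment_apply_of_not fun s j hs hx => h ⟨j, s, hs, hx⟩]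
      exact hm.adj ω x

/-- Augmenting at a cost proportional to the gain. -/
lemma exists_augment [G.LocallyFinite] {d : ℕ} (hG : G.IsTree) (hd : 0 < d)
    (hreg : G.IsRegularOfDegree d) (o : V) (hm : IsRandomMatching G m)
    {s : Fin (n + 1) × Bool → V} (hs : iidLaw V {ω | IsAugmenting G (m ω) s} ≠ 0) :
    ∃ m', IsRandomMatching G m' ∧ ∃ q : ℝ, 0 < q ∧
      (iidLaw V).real {ω | m ω o ≠ m' ω o} ≤ 2 * (n + 1) * q ∧
      (iidLaw V).real (freeSet m' o) + q ≤ (iidLaw V).real (freeSet m o) := by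
  have := countable_vertices hG.connected
  obtain ⟨D, hD⟩ : ∃ D, ∀ i j, G.dist (s i) (s j) ≤ D :=
    ⟨Finset.univ.sup fun q : (Fin (n + 1) × Bool) × (Fin (n + 1) × Bool) => G.dist (s q.1) (s q.2),
      fun i j => Finset.le_sup (f := fun q : (Fin (n + 1) × Bool) × (Fin (n + 1) × Bool) =>
        G.dist (s q.1) (s q.2)) (Finset.mem_univ (i, j))⟩
  obtain ⟨I, hI⟩ : ∃ I : Fin (n + 1) × Bool → TopologicalSpace.countableBasis unitInterval,
      iidLaw V {ω | IsSelected G m I D ω s} ≠ 0 := by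
    by_contra! hnull
    have : Countable (TopologicalSpace.countableBasis unitInterval) :=
      TopologicalSpace.countable_countableBasis unitInterval
    -- Almost surely the labels are distinct, so every occurrence of the augmenting data is isolated
    -- by some `I`. There are countably many `I`, so some one of them has positive probability.
    refine hs (measure_mono_null_ae ?_ (measure_iUnion_null hnull))
    filter_upwards [ae_labels_injective (V := V)] with ω hω
    intro ha
    choose I h1 h2 using fun j => exists_isolating_open hω
      (finite_ball hG.connected (s j) (2 * D)) (s j)
    exact Set.mem_iUnion.2 ⟨I, ha, hD, h1, h2⟩
  let q := (iidLaw V).real (selectedSet G m I D (0, false) o)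
  have hq : ∀ j, (iidLaw V).real (selectedSet G m I D j o) = q := fun j => by
    simp only [q, measureReal_def, measure_selectedSet_eq hG hd hreg o hm j (0, false)]
  refine ⟨augment G m I D, hm.augment hG.connected, q, ?_, ?_, ?_⟩
  · refine ENNReal.toReal_pos ?_ (measure_ne_top _ _)
    rw [← (isRandomSet_selectedSet hm (0, false)).measure_eq_root hG hd hreg o (s (0, false))]
    exact fun h => hI (measure_mono_null (t := selectedSet G m I D (0, false) (s (0, false)))
      (fun ω hω => ⟨s, hω, rfl⟩) h)
  -- The root is altered only if it carries one of the `2 * (n + 1)` indices, each with the same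
  -- probability `q`. Below, index `(0, false)` alone accounts for the gain: it was free and becomes
  -- matched, and no vertex becomes free.
  · have hsub : {ω | m ω o ≠ augment G m I D ω o} ⊆
        ⋃ j ∈ (Finset.univ : Finset (Fin (n + 1) × Bool)), selectedSet G m I D j o := by
      intro ω hω
      by_contra hnot
      refine hω (augment_apply_of_not fun s j hs hx => hnot ?_).symm
      exact Set.mem_iUnion₂.2 ⟨j, Finset.mem_univ _, s, hs, hx⟩
    refine (measureReal_mono hsub (measure_ne_top _ _)).trans ((measureReal_biUnion_finset_le _ _).trans ?_)
    rw [Finset.sum_congr rfl fun j _ => hq j, Finset.sum_const, Finset.card_univ, nsmul_eq_mul]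
    simp [Fintype.card_prod, mul_comm]
  · have hC := (isRandomSet_selectedSet (I := I) (D := D) hm (0, false)).measurableSet o
    rw [← measureReal_union _ hC]
    · refine measureReal_mono (Set.union_subset ?_ ?_)
      · intro ω hω
        have hω' : augment G m I D ω o = o := hω
        by_cases h : ∃ j s, IsSelected G m I D ω s ∧ s j = o
        · obtain ⟨j, s, hs, rfl⟩ := h
          rw [augment_apply_of_isSelected hG.connected hs] at hω'
          have := congrArg Prod.snd (hs.isAugmenting.inj hω')
          simp at this
        · rw [augment_apply_of_not fun s j hs hx => h ⟨j, s, hs, hx⟩] at hω'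
          exact hω'
      · rintro ω ⟨s, hs, rfl⟩
        exact hs.isAugmenting.free
    · rw [Set.disjoint_left]
      rintro ω hω ⟨s, hs, rfl⟩
      have hω' : augment G m I D ω (s (0, false)) = s (0, false) := hω
      rw [augment_apply_of_isSelected hG.connected hs] at hω'
      have := congrArg Prod.snd (hs.isAugmenting.inj hω')
      simp at this

end Augmentation

/-! ### Variational principle and passage to the limit -/

section Limit

variable {V : Type*} {G : SimpleGraph V}

lemma succ_mul_pow_le (K : ℕ) : ((K : ℝ) + 1) * (49 / 50) ^ K ≤ 49 := by
  have h := one_add_mul_le_pow (a := (1 / 49 : ℝ)) (by norm_num) K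
  have h2 : (1 + 1 / 49 : ℝ) ^ K * (49 / 50) ^ K = 1 := by rw [← mul_pow]; norm_num
  have h3 : (0 : ℝ) < (49 / 50) ^ K := by positivity
  have h4 : ((K : ℝ) + 1) ≤ 49 * (1 + 1 / 49 : ℝ) ^ K := by linarith
  calc ((K : ℝ) + 1) * (49 / 50) ^ K ≤ 49 * (1 + 1 / 49 : ℝ) ^ K * (49 / 50) ^ K := by gcongr
    _ = 49 := by rw [mul_assoc, h2, mul_one]

/-- The probability that `o` is free. -/
noncomputable def freeProb (o : V) (m : Labels V → V → V) : ℝ := (iidLaw V).real (freeSet m o)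

/-- The probability that two matchings differ at `o`. -/
noncomputable def diffProb (o : V) (m m' : Labels V → V → V) : ℝ :=
  (iidLaw V).real {ω | m ω o ≠ m' ω o}

lemma freeProb_nonneg (o : V) (m : Labels V → V → V) : 0 ≤ freeProb o m := measureReal_nonneg

lemma diffProb_nonneg (o : V) (m m' : Labels V → V → V) : 0 ≤ diffProb o m m' := measureReal_nonneg

lemma diffProb_triangle (o : V) (m₁ m₂ m₃ : Labels V → V → V) :
    diffProb o m₁ m₃ ≤ diffProb o m₁ m₂ + diffProb o m₂ m₃ := by
  refine (measureReal_mono (fun ω hω => ?_) (measure_ne_top _ _)).trans (measureReal_union_le _ _)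
  by_cases h : m₁ ω o = m₂ ω o
  · exact Or.inr fun h' => hω (h.trans h')
  · exact Or.inl h

lemma freeProb_le_add (o : V) (m m' : Labels V → V → V) :
    freeProb o m ≤ freeProb o m' + diffProb o m m' := by
  refine (measureReal_mono (fun ω hω => ?_) (measure_ne_top _ _)).trans (measureReal_union_le _ _)
  by_cases h : m ω o = m' ω o
  · exact Or.inl (h.symm.trans hω)
  · exact Or.inr h

lemma diffProb_comm (o : V) (m m' : Labels V → V → V) : diffProb o m m' = diffProb o m' m := by
  unfold diffProb
  simp only [ne_comm]

/-- The order in the variational principle: `m'` improves on `m` at a proportional cost. -/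
def Improves (o : V) (m m' : Labels V → V → V) : Prop :=
  diffProb o m m' ≤ 196 * (√(freeProb o m) - √(freeProb o m'))

lemma Improves.refl (o : V) (m : Labels V → V → V) : Improves o m m := by
  simp [Improves, diffProb]

lemma Improves.trans {o : V} {m₁ m₂ m₃ : Labels V → V → V} (h : Improves o m₁ m₂)
    (h' : Improves o m₂ m₃) : Improves o m₁ m₃ := by
  unfold Improves at *
  linarith [diffProb_triangle o m₁ m₂ m₃]

/-- With `K + 1` the first exponent whose power of 17/18 is below p, augmenting paths of index at
most `K` exist while p ≤ (17/18)^K. So the cost 2(K+1)q is controlled by (K+1)√p times the drop of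
√p, and (K+1)√p is at most 49; the constant 196 is 4 · 49. -/
lemma IsRandomMatching.exists_improves [G.LocallyFinite] {d : ℕ} (hG : G.IsTree) (hd : 3 ≤ d)
    (hreg : G.IsRegularOfDegree d) (o : V) {m : Labels V → V → V} (hm : IsRandomMatching G m)
    (hp : 0 < freeProb o m) :
    ∃ m', IsRandomMatching G m' ∧ Improves o m m' ∧ freeProb o m' < freeProb o m := by
  classical
  have hex : ∃ N, (17 / 18 : ℝ) ^ N < freeProb o m :=
    exists_pow_lt_of_lt_one hp (by norm_num)
  have hp1 : freeProb o m ≤ 1 := measureReal_le_one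
  obtain ⟨K, hK⟩ : ∃ K, Nat.find hex = K + 1 := by
    refine Nat.exists_eq_succ_of_ne_zero fun h => ?_
    have := Nat.find_spec hex
    rw [h, pow_zero] at this
    linarith
  have h1 : (17 / 18 : ℝ) ^ (K + 1) < freeProb o m := hK ▸ Nat.find_spec hex
  have h2 : freeProb o m ≤ (17 / 18 : ℝ) ^ K := not_lt.1 (Nat.find_min hex (by omega))
  obtain ⟨n, hn, s, hs⟩ := hm.exists_isAugmenting hG hd hreg o K h1
  obtain ⟨m', hm', q, hq, hcost, hgain⟩ := exists_augment hG (by omega) hreg o hm hs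
  change freeProb o m' + q ≤ freeProb o m at hgain
  refine ⟨m', hm', ?_, by linarith⟩
  have hs0 : 0 < √(freeProb o m) := Real.sqrt_pos.2 hp
  have hs1 : √(freeProb o m') ≤ √(freeProb o m) := Real.sqrt_le_sqrt (by linarith)
  have hs2 : 0 ≤ √(freeProb o m') := Real.sqrt_nonneg _
  -- The inequality 17/18 ≤ (49/50)² replaces √(17/18) by a rational number.
  have hsq : √(freeProb o m) ≤ (49 / 50) ^ K := by
    rw [Real.sqrt_le_left (by positivity)]
    refine h2.trans ?_
    rw [← pow_mul, mul_comm, pow_mul]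
    exact pow_le_pow_left₀ (by norm_num) (by norm_num) K
  have hKs : ((K : ℝ) + 1) * √(freeProb o m) ≤ 49 :=
    (mul_le_mul_of_nonneg_left hsq (by positivity)).trans (succ_mul_pow_le K)
  have hdiff : q ≤ (√(freeProb o m) - √(freeProb o m')) * (2 * √(freeProb o m)) := by
    have e1 := Real.sq_sqrt hp.le
    have e2 := Real.sq_sqrt (freeProb_nonneg o m')
    nlinarith
  have hn' : (n : ℝ) ≤ K := by exact_mod_cast hn
  unfold Improves
  calc diffProb o m m' ≤ 2 * (n + 1) * q := hcost
    _ ≤ 2 * (K + 1) * ((√(freeProb o m) - √(freeProb o m')) * (2 * √(freeProb o m))) := by gcongr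
    _ = 4 * (((K : ℝ) + 1) * √(freeProb o m)) * (√(freeProb o m) - √(freeProb o m')) := by ring
    _ ≤ 4 * 49 * (√(freeProb o m) - √(freeProb o m')) := by
      have : 0 ≤ √(freeProb o m) - √(freeProb o m') := by linarith
      gcongr
    _ = _ := by ring

/-- It suffices to cover at least half of the distance from √p to the infimum over all improvements.
If that infimum is √p itself, `m` is already optimal. -/
lemma exists_nearly_optimal (o : V) {m : Labels V → V → V} (hm : IsRandomMatching G m) :
    ∃ m', IsRandomMatching G m' ∧ Improves o m m' ∧
      ∀ m'', IsRandomMatching G m'' → Improves o m m'' →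
        2 * √(freeProb o m') - √(freeProb o m) ≤ √(freeProb o m'') := by
  let S : Set ℝ := {t | ∃ m', IsRandomMatching G m' ∧ Improves o m m' ∧ √(freeProb o m') = t}
  have hbdd : BddBelow S := ⟨0, by rintro _ ⟨m', -, -, rfl⟩; exact Real.sqrt_nonneg _⟩
  have hmem : √(freeProb o m) ∈ S := ⟨m, hm, Improves.refl o m, rfl⟩
  have hle : sInf S ≤ √(freeProb o m) := csInf_le hbdd hmem
  rcases hle.eq_or_lt with h | h
  · refine ⟨m, hm, Improves.refl o m, fun m'' h1 h2 => ?_⟩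
    have := csInf_le hbdd (⟨m'', h1, h2, rfl⟩ : √(freeProb o m'') ∈ S)
    linarith
  · obtain ⟨_, ⟨m', h1, h2, rfl⟩, h3⟩ := exists_lt_of_csInf_lt ⟨_, hmem⟩
      (show sInf S < (sInf S + √(freeProb o m)) / 2 by linarith)
    refine ⟨m', h1, h2, fun m'' h1' h2' => ?_⟩
    have := csInf_le hbdd (⟨m'', h1', h2', rfl⟩ : √(freeProb o m'') ∈ S)
    linarith

open Classical in
/-- The eventual value of a sequence of matchings. -/
noncomputable def eventualMatching (m : ℕ → Labels V → V → V) : Labels V → V → V := fun ω x =>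
  if h : ∃ y, ∀ᶠ i in Filter.atTop, m i ω x = y then h.choose else x

lemma eventualMatching_eq {m : ℕ → Labels V → V → V} {ω : Labels V} {x y : V}
    (h : ∀ᶠ i in Filter.atTop, m i ω x = y) : eventualMatching m ω x = y := by
  have h' : ∃ y, ∀ᶠ i in Filter.atTop, m i ω x = y := ⟨y, h⟩
  unfold eventualMatching
  rw [dif_pos h']
  obtain ⟨i, h1, h2⟩ := (h'.choose_spec.and h).exists
  exact h1.symm.trans h2

lemma eventualMatching_eq_self {m : ℕ → Labels V → V → V} {ω : Labels V} {x : V}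
    (h : ¬ ∃ y, ∀ᶠ i in Filter.atTop, m i ω x = y) : eventualMatching m ω x = x := by
  unfold eventualMatching
  rw [dif_neg h]

lemma isRandomMatching_eventualMatching [Countable V] {m : ℕ → Labels V → V → V}
    (hm : ∀ i, IsRandomMatching G (m i)) : IsRandomMatching G (eventualMatching m) where
  measurableSet x y := by
    have hev : ∀ y, MeasurableSet {ω | ∀ᶠ i in Filter.atTop, m i ω x = y} := fun y => by
      simp only [Filter.eventually_atTop]
      have : {ω | ∃ a, ∀ b ≥ a, m b ω x = y} = ⋃ a, ⋂ b, ⋂ (_ : b ≥ a), {ω | m b ω x = y} := by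
        ext ω; simp
      rw [this]
      exact MeasurableSet.iUnion fun a => MeasurableSet.iInter fun b => MeasurableSet.iInter fun _ =>
        (hm b).measurableSet x y
    have : {ω | eventualMatching m ω x = y} = {ω | ∀ᶠ i in Filter.atTop, m i ω x = y} ∪
        ((⋃ z, {ω | ∀ᶠ i in Filter.atTop, m i ω x = z})ᶜ ∩ {_ω | x = y}) := by
      ext ω
      by_cases h : ∃ z, ∀ᶠ i in Filter.atTop, m i ω x = z
      · obtain ⟨z, hz⟩ := h
        have h1 : ∀ y, (∀ᶠ i in Filter.atTop, m i ω x = y) ↔ z = y := fun y =>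
          ⟨fun h => by rw [← eventualMatching_eq hz, eventualMatching_eq h], fun h => h ▸ hz⟩
        simp only [Set.mem_ofPred_eq, Set.mem_union, Set.mem_inter_iff, Set.mem_compl_iff,
          Set.mem_iUnion, eventualMatching_eq hz, h1]
        simp
      · simp only [Set.mem_ofPred_eq, Set.mem_union, Set.mem_inter_iff, Set.mem_compl_iff,
          Set.mem_iUnion, eventualMatching_eq_self h, h, not_false_eq_true, true_and]
        exact ⟨Or.inr, fun h' => h'.resolve_left fun h'' => h ⟨y, h''⟩⟩
    rw [this]
    exact (hev y).union ((MeasurableSet.iUnion hev).compl.inter (MeasurableSet.const _))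
  equivariant γ ω x := by
    by_cases h : ∃ z, ∀ᶠ i in Filter.atTop, m i ω x = z
    · obtain ⟨z, hz⟩ := h
      rw [eventualMatching_eq hz]
      refine eventualMatching_eq (hz.mono fun i hi => ?_)
      rw [(hm i).equivariant, hi]
    · rw [eventualMatching_eq_self h, eventualMatching_eq_self]
      rintro ⟨z, hz⟩
      refine h ⟨γ.symm z, hz.mono fun i hi => ?_⟩
      rw [← hi, (hm i).equivariant, RelIso.symm_apply_apply]
  invol ω x := by
    by_cases h : ∃ z, ∀ᶠ i in Filter.atTop, m i ω x = z
    · obtain ⟨z, hz⟩ := h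
      rw [eventualMatching_eq hz]
      refine eventualMatching_eq (hz.mono fun i hi => ?_)
      rw [← hi, (hm i).invol]
    · rw [eventualMatching_eq_self h, eventualMatching_eq_self h]
  adj ω x := by
    by_cases h : ∃ z, ∀ᶠ i in Filter.atTop, m i ω x = z
    · obtain ⟨z, hz⟩ := h
      rw [eventualMatching_eq hz]
      obtain ⟨i, hi⟩ := hz.exists
      exact hi ▸ (hm i).adj ω x
    · exact Or.inl (eventualMatching_eq_self h)

lemma isRandomMatching_id : IsRandomMatching G (fun _ x => x) where
  measurableSet _ _ := MeasurableSet.const _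
  equivariant _ _ _ := rfl
  invol _ _ := rfl
  adj _ _ := Or.inl rfl

lemma eventually_eq_of_forall_succ {α : Type*} {u : ℕ → α} {N : ℕ}
    (h : ∀ k, u (N + k) = u (N + k + 1)) : ∀ᶠ i in Filter.atTop, u i = u N := by
  filter_upwards [Filter.eventually_ge_atTop N] with i hi
  obtain ⟨k, rfl⟩ := Nat.exists_eq_add_of_le hi
  induction k with
  | zero => rfl
  | succ k ih => exact (h k).symm.trans (ih (by omega))

/-- The limit of a sequence of successive improvements. -/
lemma improves_eventualMatching (o : V) {m : ℕ → Labels V → V → V}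
    (himp : ∀ i, Improves o (m i) (m (i + 1))) :
    (∀ i, Improves o (m i) (eventualMatching m)) ∧
      Filter.Tendsto (fun i => √(freeProb o (m i))) Filter.atTop
        (nhds √(freeProb o (eventualMatching m))) := by
  let φ : ℕ → ℝ := fun i => √(freeProb o (m i))
  have hstep : ∀ i, diffProb o (m i) (m (i + 1)) ≤ 196 * (φ i - φ (i + 1)) := himp
  have hanti : Antitone φ := antitone_nat_of_succ_le fun i => by
    linarith [hstep i, diffProb_nonneg o (m i) (m (i + 1))]
  have hbdd : BddBelow (Set.range φ) := ⟨0, by rintro _ ⟨i, rfl⟩; exact Real.sqrt_nonneg _⟩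
  set L := ⨅ i, φ i
  have hlim : Filter.Tendsto φ Filter.atTop (nhds L) := tendsto_atTop_ciInf hanti hbdd
  have hLle : ∀ i, L ≤ φ i := fun i => ciInf_le hbdd i
  -- The costs telescope. Borel–Cantelli makes the partner of `o` eventually constant, and the tail
  -- sums bound the distance to the limit.
  have hsum : ∀ j, ∑' k, iidLaw V {ω | m (j + k) ω o ≠ m (j + k + 1) ω o} ≤
      ENNReal.ofReal (196 * (φ j - L)) := by
    intro j
    refine ENNReal.tsum_le_of_sum_range_le fun n => ?_
    have h1 : ∀ n, ∑ k ∈ Finset.range n, diffProb o (m (j + k)) (m (j + k + 1)) ≤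
        196 * (φ j - φ (j + n)) := by
      intro n
      induction n with
      | zero => simp
      | succ n ih =>
        rw [Finset.sum_range_succ]
        have := hstep (j + n)
        rw [← add_assoc]
        linarith
    have h2 : ∀ k, iidLaw V {ω | m (j + k) ω o ≠ m (j + k + 1) ω o} =
        ENNReal.ofReal (diffProb o (m (j + k)) (m (j + k + 1))) := fun k =>
      (ofReal_measureReal (measure_ne_top _ _)).symm
    rw [Finset.sum_congr rfl fun k _ => h2 k,
      ← ENNReal.ofReal_sum_of_nonneg fun k _ => diffProb_nonneg o _ _]
    exact ENNReal.ofReal_le_ofReal ((h1 n).trans (by linarith [hLle (j + n)]))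
  have hev : ∀ᵐ ω ∂iidLaw V, ∀ᶠ i in Filter.atTop, m i ω o = m (i + 1) ω o := by
    have h := ae_eventually_notMem (μ := iidLaw V) (s := fun i => {ω | m i ω o ≠ m (i + 1) ω o})
      (by
        have := hsum 0
        simp only [zero_add] at this
        exact ne_top_of_le_ne_top ENNReal.ofReal_ne_top this)
    filter_upwards [h] with ω hω
    filter_upwards [hω] with i hi
    simpa using hi
  have hdiff : ∀ j, diffProb o (m j) (eventualMatching m) ≤ 196 * (φ j - L) := by
    intro j
    refine ENNReal.toReal_le_of_le_ofReal (by linarith [hLle j]) ?_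
    refine le_trans ?_ ((measure_iUnion_le _).trans (hsum j))
    refine measure_mono_ae ?_
    filter_upwards [hev] with ω hω
    intro hne
    by_contra hnot
    have hnot' : ∀ k, m (j + k) ω o = m (j + k + 1) ω o := fun k => by
      by_contra h
      exact hnot (Set.mem_iUnion.2 ⟨k, h⟩)
    exact hne (eventualMatching_eq (eventually_eq_of_forall_succ
      (u := fun i => m i ω o) hnot')).symm
  have hp : Filter.Tendsto (fun i => freeProb o (m i)) Filter.atTop
      (nhds (freeProb o (eventualMatching m))) := by
    have h0 : Filter.Tendsto (fun i => 196 * (φ i - L)) Filter.atTop (nhds 0) := by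
      have := (hlim.sub_const L).const_mul 196
      simpa using this
    rw [tendsto_iff_dist_tendsto_zero]
    refine squeeze_zero (fun _ => dist_nonneg) (fun i => ?_) h0
    rw [Real.dist_eq, abs_le]
    have h1 := freeProb_le_add o (m i) (eventualMatching m)
    have h2 := freeProb_le_add o (eventualMatching m) (m i)
    rw [diffProb_comm] at h2
    constructor <;> linarith [hdiff i]
  have hφ : Filter.Tendsto φ Filter.atTop (nhds √(freeProb o (eventualMatching m))) := hp.sqrt
  refine ⟨fun i => ?_, hφ⟩
  have hL : L = √(freeProb o (eventualMatching m)) := tendsto_nhds_unique hlim hφ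
  have := hdiff i
  rwa [hL] at this

/-- There is an equivariant measurable matching that is almost surely perfect. -/
lemma exists_isRandomMatching_freeProb_eq_zero [G.LocallyFinite] {d : ℕ} (hG : G.IsTree)
    (hd : 3 ≤ d) (hreg : G.IsRegularOfDegree d) (o : V) :
    ∃ m, IsRandomMatching G m ∧ freeProb o m = 0 := by
  have := countable_vertices hG.connected
  choose! nxt h1 h2 h3 using fun (m : Labels V → V → V) (hm : IsRandomMatching G m) =>
    exists_nearly_optimal o hm
  let m : ℕ → Labels V → V → V := fun i => nxt^[i] (fun _ x => x)
  have hsucc : ∀ i, m (i + 1) = nxt (m i) := fun i => Function.iterate_succ_apply' _ _ _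
  have hm : ∀ i, IsRandomMatching G (m i) := by
    intro i
    induction i with
    | zero => exact isRandomMatching_id
    | succ i ih => rw [hsucc]; exact h1 _ ih
  have himp : ∀ i, Improves o (m i) (m (i + 1)) := fun i => by rw [hsucc]; exact h2 _ (hm i)
  obtain ⟨hI, hlim⟩ := improves_eventualMatching o himp
  have hrm := isRandomMatching_eventualMatching hm
  refine ⟨eventualMatching m, hrm, ?_⟩
  by_contra hne
  have hpos : 0 < freeProb o (eventualMatching m) :=
    lt_of_le_of_ne (freeProb_nonneg _ _) (Ne.symm hne)
  obtain ⟨m', hm', himp', hlt⟩ := hrm.exists_improves hG hd hreg o hpos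
  -- By transitivity, the improvement `m'` of the limit improves every term of the sequence and so
  -- competes in every near-optimality condition. In the limit its √p would be at least 2L - L = L,
  -- where L is the value at the limit matching.
  have hle : ∀ i, 2 * √(freeProb o (m (i + 1))) - √(freeProb o (m i)) ≤ √(freeProb o m') :=
    fun i => by rw [hsucc]; exact h3 _ (hm i) m' hm' ((hI i).trans himp')
  have h4 := le_of_tendsto' (((hlim.comp (Filter.tendsto_add_atTop_nat 1)).const_mul 2).sub hlim) hle
  have h5 := Real.sqrt_lt_sqrt (freeProb_nonneg o m') hlt
  linarith

end Limit

/-! ### From matchings of vertices to laws on edge configurations -/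

section Existence

variable {V : Type*} {G : SimpleGraph V}

/-- A local description with only vertex and neighbour quantifiers, from which measurability is
immediate. -/
lemma mem_perfectMatchings_iff_forall (ω : Config G) : ω ∈ perfectMatchings G ↔
    ∀ v, ∃ w : G.neighborSet v, ω ⟨s(v, w.1), w.2⟩ = true ∧
      ∀ w' : G.neighborSet v, w' ≠ w → ω ⟨s(v, w'.1), w'.2⟩ = false := by
  constructor
  · intro h v
    obtain ⟨m, hm, hω⟩ := (mem_perfectMatchings_iff ω).1 h
    have h1 : ω ⟨s(v, m v), hm.adj v⟩ = true := (hω _).2 ⟨v, rfl⟩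
    exact ⟨⟨m v, hm.adj v⟩, h1, fun w' hw' =>
      (eq_true_iff_of_mem_perfectMatchings h (hm.adj v)).1 h1 w'.1 w'.2
        fun h => hw' (Subtype.ext h)⟩
  · intro h
    choose m hm hu using h
    have huniq : ∀ v w (hw : G.Adj v w), ω ⟨s(v, w), hw⟩ = true → w = (m v).1 := by
      intro v w hw h1
      by_contra hne
      have := hu v ⟨w, hw⟩ fun h => hne (congrArg Subtype.val h)
      simp [h1] at this
    have hswap : ∀ v w (hw : G.Adj v w), ω ⟨s(v, w), hw⟩ = true →
        ω ⟨s(w, v), hw.symm⟩ = true := by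
      intro v w hw h1
      rw [← h1]
      congr 2
      exact Sym2.eq_swap
    refine (mem_perfectMatchings_iff ω).2 ⟨fun v => (m v).1, ⟨fun v => (m v).2, fun v => ?_⟩,
      fun e => ?_⟩
    · exact (huniq _ _ _ (hswap _ _ _ (hm v))).symm
    · obtain ⟨e, he⟩ := e
      induction e with
      | h a b =>
        constructor
        · intro h1
          exact ⟨a, congrArg (fun w => s(a, w)) (huniq a b he h1)⟩
        · rintro ⟨v, hv⟩
          rw [← hm v]
          congr 2

lemma measurableSet_perfectMatchings [Countable V] : MeasurableSet (perfectMatchings G) := by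
  have h : perfectMatchings G = ⋂ v, ⋃ w : G.neighborSet v,
      ({ω | ω ⟨s(v, w.1), w.2⟩ = true} ∩ ⋂ w' : G.neighborSet v,
        ({_ω | w' ≠ w}ᶜ ∪ {ω | ω ⟨s(v, w'.1), w'.2⟩ = false})) := by
    ext ω
    rw [mem_perfectMatchings_iff_forall]
    simp only [Set.mem_iInter, Set.mem_iUnion, Set.mem_inter_iff, Set.mem_ofPred_eq, Set.mem_union,
      Set.mem_compl_iff, ← imp_iff_not_or]
  rw [h]
  have hev : ∀ (e : G.edgeSet) b, MeasurableSet {ω : Config G | ω e = b} := fun e b =>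
    (measurable_pi_apply e : Measurable fun ω : Config G => ω e) (measurableSet_singleton b)
  exact MeasurableSet.iInter fun v => MeasurableSet.iUnion fun w => (hev _ _).inter
    (MeasurableSet.iInter fun w' => (MeasurableSet.const _).compl.union (hev _ _))

open Classical in
/-- The set of edges of a random matching. -/
noncomputable def matchingConfig (G : SimpleGraph V) (m : Labels V → V → V) :
    Labels V → Config G :=
  fun ω e => decide (∃ v, (e : Sym2 V) = s(v, m ω v))

lemma matchingConfig_eq_true_iff (m : Labels V → V → V) (ω : Labels V) (e : G.edgeSet) :
    matchingConfig G m ω e = true ↔ ∃ v, (e : Sym2 V) = s(v, m ω v) := by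
  simp [matchingConfig]

namespace IsRandomMatching

variable {m : Labels V → V → V}

lemma measurable_matchingConfig [Countable V] (hm : IsRandomMatching G m) :
    Measurable (matchingConfig G m) := by
  refine measurable_pi_lambda _ fun e => measurable_to_bool ?_
  have : (fun ω => matchingConfig G m ω e) ⁻¹' {true} =
      ⋃ v, ⋃ w, ({ω | m ω v = w} ∩ {_ω | (e : Sym2 V) = s(v, w)}) := by
    ext ω
    simp only [Set.mem_preimage, Set.mem_singleton_iff, matchingConfig_eq_true_iff, Set.mem_iUnion,
      Set.mem_inter_iff, Set.mem_ofPred_eq, exists_eq_left']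
  rw [this]
  exact MeasurableSet.iUnion fun v => MeasurableSet.iUnion fun w =>
    (hm.measurableSet v w).inter (MeasurableSet.const _)

lemma matchingConfig_actLabels (hm : IsRandomMatching G m) (γ : G ≃g G) (ω : Labels V) :
    matchingConfig G m (actLabels γ ω) = actConfig γ (matchingConfig G m ω) :=
  (actConfig_eq_of_partner γ (matchingConfig_eq_true_iff m ω)
    (matchingConfig_eq_true_iff m (actLabels γ ω)) fun v => (hm.equivariant γ ω v).symm).symm

lemma isFIID_map [Countable V] (hm : IsRandomMatching G m) :
    IsFIID G ((iidLaw V).map (matchingConfig G m)) :=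
  ⟨matchingConfig G m, hm.measurable_matchingConfig, hm.matchingConfig_actLabels, rfl⟩

lemma isInvariantMatchingLaw_map [G.LocallyFinite] {d : ℕ} (hG : G.IsTree)
    (hd : 0 < d) (hreg : G.IsRegularOfDegree d) (o : V) (hm : IsRandomMatching G m)
    (h0 : freeProb o m = 0) :
    IsInvariantMatchingLaw G ((iidLaw V).map (matchingConfig G m)) := by
  have := countable_vertices hG.connected
  have hφ := hm.measurable_matchingConfig
  refine ⟨Measure.isProbabilityMeasure_map hφ.aemeasurable, ?_, fun γ => ?_⟩
  · refine (ae_map_iff (p := fun ω => ω ∈ perfectMatchings G) hφ.aemeasurable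
      measurableSet_perfectMatchings).2 ?_
    have hfree : ∀ᵐ ω ∂iidLaw V, ∀ v, m ω v ≠ v := by
      refine ae_all_iff.2 fun v => ?_
      rw [ae_iff]
      simp only [ne_eq, not_not]
      refine (hm.freeSet.measure_eq_root hG hd hreg o v).trans ?_
      exact (measureReal_eq_zero_iff (measure_ne_top _ _)).1 h0
    filter_upwards [hfree] with ω hω
    exact (mem_perfectMatchings_iff _).2 ⟨m ω,
      ⟨fun v => (hm.adj ω v).resolve_left (hω v), hm.invol ω⟩, matchingConfig_eq_true_iff m ω⟩
  · refine ⟨measurable_actConfig γ, ?_⟩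
    have h1 : actConfig γ ∘ matchingConfig G m = matchingConfig G m ∘ actLabels γ :=
      funext fun ω => (hm.matchingConfig_actLabels γ ω).symm
    have h2 := measurePreserving_actLabels (V := V) γ
    rw [Measure.map_map (measurable_actConfig γ) hφ, h1, ← Measure.map_map hφ h2.measurable,
      h2.map_eq]

end IsRandomMatching

end Existence

end TreeMatching

theorem propositionp {V : Type*} (d : ℕ) (hd : 3 ≤ d) (G : SimpleGraph V) [G.LocallyFinite]
    (hG : G.IsTree) (hreg : G.IsRegularOfDegree d) (o : V) :
    (∃! μ : Measure (TreeMatching.Config G), TreeMatching.IsInvariantMatchingLaw G μ) ∧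
    (∀ μ : Measure (TreeMatching.Config G), TreeMatching.IsInvariantMatchingLaw G μ →
      TreeMatching.IsFIID G μ ∧ TreeMatching.HasFullTail G o μ) ∧
    -- the trace of the tail field on the set of perfect matchings is the whole Borel field
    (TreeMatching.tailField G o).comap
        (Subtype.val : TreeMatching.perfectMatchings G → TreeMatching.Config G) =
      Subtype.instMeasurableSpace := by
  have hd0 : 0 < d := by omega
  have := TreeMatching.countable_vertices hG.connected
  obtain ⟨m, hm, h0⟩ :=
    TreeMatching.exists_isRandomMatching_freeProb_eq_zero hG hd hreg o
  have hμ := hm.isInvariantMatchingLaw_map hG hd0 hreg o h0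
  have huniq : ∀ ν, TreeMatching.IsInvariantMatchingLaw G ν →
      ν = (TreeMatching.iidLaw V).map (TreeMatching.matchingConfig G m) :=
    fun ν hν => hν.unique hG hd0 hreg hμ
  refine ⟨⟨_, hμ, huniq⟩, fun ν hν => ⟨?_, TreeMatching.hasFullTail hG o hν.carried⟩,
    TreeMatching.comap_tailField_eq hG o⟩
  rw [huniq ν hν]
  exact hm.isFIID_map
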